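/- **Setting.** Modules are right modules. Let $R$ be an integral domain with field of fractions $\mathbb F$. A cell datum for a unital $R$-algebra $A$ consists of an $R$-linear algebra involution (anti-automorphism) $*$, a finite poset $(\widehat A,\unrhd)$, non-empty finite sets $\mathrm{Std}(\lambda)$ $(\lambda\in\widehat A)$, and an $R$-basis $\{c^\lambda_{st}\mid \lambda\in\widehat A,\ s,t\in \mathrm{Std}(\lambda)\}$ of $A$ such that, writing $A^{\rhd\lambda}$ (resp. $A^{\unrhd\lambda}$) for the span of the $c^\mu_{st}$ with $\mu\rhd\lambda$ (resp. $\mu\unrhd\lambda$): $c^\lambda_{st}a\equiv\sum_v r(a;t,v)c^\lambda_{sv} \pmod{A^{\rhd\lambda}}$ with $r(a;t,v)\in R$ independent of $s$, and $(c^\lambda_{st})^*\equiv c^\lambda_{ts} \pmod{A^{\rhd\lambda}}$. The cell module $\Delta(\lambda)$ is free over $R$ with basis $\{c_t\mid t\in \mathrm{Std}(\lambda)\}$ and $c_t a=\sum_v r(a;t,v)c_v$; and $\Delta(\lambda)^*$ denotes $\Delta(\lambda)$ as a left module via $*$. Let $A_0\subseteq A_1\subseteq A_2\subseteq\cdots$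 be unital inclusions of $R$-algebras with cell data, with consistent involutions, posets $\widehat A_r$ and cell modules $\Delta_r(\lambda)$. Write $A_r^{\mathbb F}=A_r\otimes_R\mathbb F$ and $\Delta^{\mathbb F}_r(\lambda)=\Delta_r(\lambda)\otimes_R\mathbb F$. Assume: 1. $A_0=R$. 2. Every $\Delta_r(\lambda)$ is cyclic. Fix a generator $\delta_r(\lambda)$, an $A_r$-$A_r$-bimodule isomorphism $\alpha_\lambda: A_r^{\unrhd\lambda}/A_r^{\rhd\lambda}\to\Delta_r(\lambda)^*\otimes_R\Delta_r(\lambda)$, and $m_\lambda\in A_r^{\unrhd\lambda}$ with $\alpha_\lambda(m_\lambda+A_r^{\rhd\lambda})=\delta_r(\lambda)^*\otimes\delta_r(\lambda)$. 3. $m_\lambda^*=m_\lambda$. 4. $A_r^{\mathbb F}$ is split semisimple for all $r$. 5. For every $r\ge 0$ and $\nu\in\widehat A_{r+1}$ the restriction of $\Delta_{r+1}(\nu)$ to $A_r$ has a filtration $0=N_0\subseteq N_1\subseteq\dots\subseteq N_n=\Delta_{r+1}(\nu)$ by $A_r$-submodules with $N_j/N_{j-1}\cong\Delta_r(\mu_j)$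 and $\mu_1\rhd\mu_2\rhd\dots\rhd\mu_n$. Fix such a filtration and such isomorphisms, write $\mu\to\nu$ if $\mu=\mu_j$ for some $j$, and fix branching factors $d_{\mu_j\to\nu}\in A_{r+1}$ such that $\delta_{r+1}(\nu)\,d_{\mu_j\to\nu}$ lies in $N_j$ and its class in $N_j/N_{j-1}$ corresponds to $\delta_r(\mu_j)$. 6. For every edge $\mu\to\nu$, $\mu \in \widehat A_r$, there is $u_{\mu\to\nu}\in A_{r+1}$ with $m_\nu d_{\mu\to\nu}=(u_{\mu\to\nu})^*m_\mu$. 7. For each $r$ there is an $R$-algebra automorphism $f_r$ of $A_r$ with $f_r^2=\mathrm{id}$ such that $f_r(A_{r-s})$ commutes with $A_s$ for all $0\le s\le r$. For $0\le s\le r$ let $\varphi_{r,s}:A_s\otimes_R A_{r-s}\to A_r$, $a\otimes b\mapsto a\,f_r(f_{r-s}(b))$; via $\varphi_{r,s}$ (extended to $\mathbb F$) every $A_r^{\mathbb F}$-module restricts to $A_s^{\mathbb F}\otimes_{\mathbb F} A_{r-s}^{\mathbb F}$. For $\nu\in\widehat A_r$ let $\mathrm{Std}_r(\nu)$ be the set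 of paths $\mathsf t=(\mathsf t(0)\to\mathsf t(1)\to\dots\to\mathsf t(r)=\nu)$ with $\mathsf t(k)\in\widehat A_k$. Put $d_{\mathsf t}=d_{\mathsf t(r-1)\to\mathsf t(r)}\cdots d_{\mathsf t(0)\to\mathsf t(1)}$ and $m^\nu_{\mathsf t}=\delta_r(\nu)d_{\mathsf t}\in\Delta_r(\nu)$. Paths are ordered by dominance: $\mathsf t\unrhd\mathsf t'$ iff $\mathsf t(k)\unrhd\mathsf t'(k)$ for all $k$. For $\lambda\in\widehat A_s$, $\nu\in\widehat A_r$ and a path $\mathsf t^\lambda$ that is maximal in $\mathrm{Std}_s(\lambda)$, let $$\Delta(\nu;\rhd\lambda)=\mathrm{Span}_R\{m^\nu_{\mathsf t}\mid \mathsf t\in \mathrm{Std}_r(\nu),\ \mathsf t(s)\rhd\lambda\},$$ $$\Delta(\nu;\mathsf t^\lambda)=\mathrm{Span}_R\{m^\nu_{\mathsf t}\mid \mathsf t\in \mathrm{Std}_r(\nu),\ \mathsf t(k)=\mathsf t^\lambda(k)\text{ for } 0\le k\le s\}.$$ Let $A_r\cap A_s'$ be the subalgebra of elements of $A_r$ that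 commute with $A_s$. **Proposition.** Let $0\le s\le r$, $\lambda\in\widehat A_s$ and $\nu\in\widehat A_r$. A maximal path $\mathsf t^\lambda\in \mathrm{Std}_s(\lambda)$ exists, and for every such path the following holds. Both $\Delta(\nu;\rhd\lambda)$ and $\Delta(\nu;\mathsf t^\lambda)+\Delta(\nu;\rhd\lambda)$ are $A_r\cap A_s'$-submodules of $\Delta_r(\nu)$, so that the skew cell module $$\Delta_{r-s}(\nu\setminus\lambda)=\bigl(\Delta(\nu;\mathsf t^\lambda)+\Delta(\nu;\rhd\lambda)\bigr)/\Delta(\nu;\rhd\lambda),$$ regarded as an $A_{r-s}$-module via $f_r\circ f_{r-s}:A_{r-s}\to A_r\cap A_s'$, is well defined. With $\Delta^{\mathbb F}_{r-s}(\nu\setminus\lambda)=\Delta_{r-s}(\nu\setminus\lambda)\otimes_R\mathbb F$, for every $A^{\mathbb F}_{r-s}$-module $M$ there is an isomorphism of $\mathbb F$-vector spaces $$\mathrm{Hom}_{A^{\mathbb F}_s\otimes_{\mathbb F} A^{\mathbb F}_{r-s}}\bigl(\Delta^{\mathbb F}_s(\lambda)\otimes_{\mathbb F}M,\ \mathrm{Res}^{A^{\mathbb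 F}_r}_{A^{\mathbb F}_s\otimes_{\mathbb F} A^{\mathbb F}_{r-s}}\Delta^{\mathbb F}_r(\nu)\bigr)\;\cong\;\mathrm{Hom}_{A^{\mathbb F}_{r-s}}\bigl(M,\ \Delta^{\mathbb F}_{r-s}(\nu\setminus\lambda)\bigr).$$ -/

import Mathlib

open scoped TensorProduct

universe u uF v w x

/-! ### Right modules over an algebra -/

/-- A right module over the `K`-algebra `A` with underlying `K`-module `V`: an algebra homomorphism
from `A` to the opposite of `End_K V`. -/
abbrev RightRep (K : Type*) (A : Type*) (V : Type*) [CommRing K] [Ring A] [Algebra K A]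
    [AddCommGroup V] [Module K V] :=
  A →ₐ[K] (Module.End K V)ᵐᵒᵖ

namespace RightRep

/-- The element `v · a`. -/
def act {K A V : Type*} [CommRing K] [Ring A] [Algebra K A] [AddCommGroup V] [Module K V]
    (ρ : RightRep K A V) (v : V) (a : A) : V :=
  (ρ a).unop v

/-- A right module in Mathlib's sense, i.e. a module over the opposite algebra. -/
def ofModule (K A V : Type*) [CommRing K] [Ring A] [Algebra K A] [AddCommGroup V] [Module K V]
    [Module Aᵐᵒᵖ V] [IsScalarTower K Aᵐᵒᵖ V] : RightRep K A V :=
  AlgHom.opComm.symm (Algebra.lsmul K K V : Aᵐᵒᵖ →ₐ[K] Module.End K V)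

theorem ofModule_act (K A V : Type*) [CommRing K] [Ring A] [Algebra K A] [AddCommGroup V]
    [Module K V] [Module Aᵐᵒᵖ V] [IsScalarTower K Aᵐᵒᵖ V] (m : V) (a : A) :
    (ofModule K A V).act m a = MulOpposite.op a • m :=
  rfl

/-- `Hom_A (V, W)` for right `A`-modules `V`, `W`. -/
def hom {K A V W : Type*} [CommRing K] [Ring A] [Algebra K A] [AddCommGroup V] [Module K V]
    [AddCommGroup W] [Module K W] (ρ : RightRep K A V) (σ : RightRep K A W) :
    Submodule K (V →ₗ[K] W) where
  carrier := {φ | ∀ (x : V) (a : A), φ (ρ.act x a) = σ.act (φ x) a}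
  add_mem' := by
    intro φ ψ hφ hψ x a
    have h1 := hφ x a
    have h2 := hψ x a
    simp only [act, LinearMap.add_apply, map_add] at h1 h2 ⊢
    rw [h1, h2]
  zero_mem' := by
    intro x a
    simp [act]
  smul_mem' := by
    intro c φ hφ x a
    have h1 := hφ x a
    simp only [act, LinearMap.smul_apply, map_smul] at h1 ⊢
    rw [h1]

/-- Base change: the right `F ⊗ A`-module `F ⊗ V`, with `(x ⊗ v) · (y ⊗ a) = y x ⊗ v · a`. -/
noncomputable def baseChange {R A V : Type*} (F : Type*) [CommRing R] [CommRing F] [Algebra R F]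
    [Ring A] [Algebra R A] [AddCommGroup V] [Module R V] (ρ : RightRep R A V) :
    RightRep F (F ⊗[R] A) (F ⊗[R] V) :=
  Algebra.TensorProduct.lift (Algebra.ofId F _)
    ((AlgHom.op (Module.End.baseChangeHom R F V)).comp ρ)
    (fun y a => show _ * _ = _ * _ by rw [Algebra.ofId_apply]; exact Algebra.commutes y _)

theorem baseChange_act {R A V : Type*} (F : Type*) [CommRing R] [CommRing F] [Algebra R F]
    [Ring A] [Algebra R A] [AddCommGroup V] [Module R V] (ρ : RightRep R A V)
    (x y : F) (v : V) (a : A) :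
    (baseChange F ρ).act (x ⊗ₜ v) (y ⊗ₜ a) = (y * x) ⊗ₜ (ρ.act v a) := by
  change ((ρ a).unop.baseChange F) (y • (x ⊗ₜ[R] v)) = _
  rw [TensorProduct.smul_tmul', LinearMap.baseChange_tmul, smul_eq_mul]
  rfl

/-- The right `A ⊗ B`-module `V ⊗ W`, with `(v ⊗ w) · (a ⊗ b) = v · a ⊗ w · b`. -/
noncomputable def outer {K A B V W : Type*} [CommRing K] [Ring A] [Algebra K A] [Ring B]
    [Algebra K B] [AddCommGroup V] [Module K V] [AddCommGroup W] [Module K W]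
    (ρ : RightRep K A V) (σ : RightRep K B W) : RightRep K (A ⊗[K] B) (V ⊗[K] W) :=
  Algebra.TensorProduct.lift
    ((AlgHom.op (Module.End.rTensorAlgHom K V W)).comp ρ)
    ((AlgHom.op (Module.End.lTensorAlgHom K W V)).comp σ)
    (fun a b => MulOpposite.unop_injective (TensorProduct.ext' fun v w => by
      change (LinearMap.lTensor V (σ b).unop) ((LinearMap.rTensor W (ρ a).unop) (v ⊗ₜ w)) =
        (LinearMap.rTensor W (ρ a).unop) ((LinearMap.lTensor V (σ b).unop) (v ⊗ₜ w))
      simp))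

theorem outer_act {K A B V W : Type*} [CommRing K] [Ring A] [Algebra K A] [Ring B]
    [Algebra K B] [AddCommGroup V] [Module K V] [AddCommGroup W] [Module K W]
    (ρ : RightRep K A V) (σ : RightRep K B W) (v : V) (w : W) (a : A) (b : B) :
    (outer ρ σ).act (v ⊗ₜ w) (a ⊗ₜ b) = ρ.act v a ⊗ₜ σ.act w b := by
  change (LinearMap.lTensor V (σ b).unop) ((LinearMap.rTensor W (ρ a).unop) (v ⊗ₜ w)) = _
  simp [act]

/-- `U` is stable under the right action. -/
def Stable {K A V : Type*} [CommRing K] [Ring A] [Algebra K A] [AddCommGroup V] [Module K V]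
    (ρ : RightRep K A V) (U : Submodule K V) : Prop :=
  ∀ a : A, ∀ x ∈ U, ρ.act x a ∈ U

/-- The right module structure on the subquotient `U / (U ∩ W)` of `V`, for stable `U`, `W`. -/
def subquotient {K A V : Type*} [CommRing K] [Ring A] [Algebra K A] [AddCommGroup V] [Module K V]
    (ρ : RightRep K A V) (U W : Submodule K V) (hU : ρ.Stable U) (hW : ρ.Stable W) :
    RightRep K A (U ⧸ W.submoduleOf U) :=
  AlgHom.ofLinearMap
    { toFun := fun a => MulOpposite.op
        ((W.submoduleOf U).mapQ (W.submoduleOf U)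
          (((ρ a).unop).restrict (fun x hx => hU a x hx))
          (fun x hx => hW a _ hx))
      map_add' := by
        intro a b
        apply MulOpposite.unop_injective
        refine LinearMap.ext fun y => Submodule.Quotient.induction_on _ y fun x => ?_
        refine congrArg Submodule.Quotient.mk (Subtype.ext ?_)
        change (ρ (a + b)).unop (x : V) = (ρ a).unop (x : V) + (ρ b).unop (x : V)
        simp
      map_smul' := by
        intro c a
        apply MulOpposite.unop_injective
        refine LinearMap.ext fun y => Submodule.Quotient.induction_on _ y fun x => ?_
        refine congrArg Submodule.Quotient.mk (Subtype.ext ?_)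
        change (ρ (c • a)).unop (x : V) = c • (ρ a).unop (x : V)
        simp }
    (by
      apply MulOpposite.unop_injective
      refine LinearMap.ext fun y => Submodule.Quotient.induction_on _ y fun x => ?_
      refine congrArg Submodule.Quotient.mk (Subtype.ext ?_)
      change (ρ 1).unop (x : V) = (x : V)
      simp)
    (by
      intro a b
      apply MulOpposite.unop_injective
      refine LinearMap.ext fun y => Submodule.Quotient.induction_on _ y fun x => ?_
      refine congrArg Submodule.Quotient.mk (Subtype.ext ?_)
      change (ρ (a * b)).unop (x : V) = (ρ b).unop ((ρ a).unop (x : V))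
      simp)

theorem subquotient_act {K A V : Type*} [CommRing K] [Ring A] [Algebra K A] [AddCommGroup V]
    [Module K V] (ρ : RightRep K A V) (U W : Submodule K V) (hU : ρ.Stable U) (hW : ρ.Stable W)
    (x : U) (a : A) :
    (subquotient ρ U W hU hW).act (Submodule.Quotient.mk x) a =
      Submodule.Quotient.mk ⟨ρ.act (x : V) a, hU a x x.2⟩ :=
  rfl

end RightRep

/-- `A` is isomorphic, as an `F`-algebra, to a finite product of full matrix algebras over `F`. -/
def IsSplitSemisimple (F A : Type*) [Field F] [Ring A] [Algebra F A] : Prop :=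
  ∃ (n : ℕ) (d : Fin n → ℕ), Nonempty (A ≃ₐ[F] ∀ i, Matrix (Fin (d i)) (Fin (d i)) F)

/-! ### Cellular algebras -/

/-- The span of the elements `c^μ_{st}` with `μ ∈ Γ`. -/
def cellSpan (R : Type*) {A Λ : Type*} {S : Λ → Type*} [CommRing R] [Ring A] [Algebra R A]
    (c : (Σ l : Λ, S l × S l) → A) (Γ : Set Λ) : Submodule R A :=
  Submodule.span R (c '' {i | i.1 ∈ Γ})

/-- A cell datum for the `R`-algebra `A`; the order relation `μ ⊵ λ` is written `l ≤ μ`.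
The index sets `Std l` are nonempty. -/
structure CellDatum (R : Type u) (A : Type v) [CommRing R] [Ring A] [Algebra R A] where
  /-- the algebra involution -/
  inv : A →ₗ[R] A
  inv_mul : ∀ a b, inv (a * b) = inv b * inv a
  inv_inv : ∀ a, inv (inv a) = a
  /-- the finite partially ordered set -/
  Λ : Type w
  [order : PartialOrder Λ]
  [finite : Finite Λ]
  /-- the finite index sets -/
  Std : Λ → Type x
  [fintype : ∀ l, Fintype (Std l)]
  [nonempty : ∀ l, Nonempty (Std l)]
  /-- the cellular basis -/
  c : Module.Basis (Σ l : Λ, Std l × Std l) R A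
  mul_mem : ∀ (l : Λ) (t : Std l) (a : A), ∃ r : Std l → R, ∀ s : Std l,
    c ⟨l, s, t⟩ * a - ∑ v, r v • c ⟨l, s, v⟩ ∈ cellSpan R c (Set.Ioi l)
  inv_mem : ∀ (l : Λ) (s t : Std l),
    inv (c ⟨l, s, t⟩) - c ⟨l, t, s⟩ ∈ cellSpan R c (Set.Ioi l)

attribute [instance] CellDatum.order CellDatum.finite CellDatum.fintype CellDatum.nonempty

namespace CellDatum

/-- `A^{▷ l}`. -/
noncomputable def gt {R A : Type*} [CommRing R] [Ring A] [Algebra R A] (D : CellDatum R A) (l : D.Λ) :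
    Submodule R A :=
  cellSpan R D.c (Set.Ioi l)

/-- `A^{⊵ l}`. -/
noncomputable def ge {R A : Type*} [CommRing R] [Ring A] [Algebra R A] (D : CellDatum R A) (l : D.Λ) :
    Submodule R A :=
  cellSpan R D.c (Set.Ici l)

/-- The underlying module of the cell module of `l`: free with basis indexed by `Std l`. -/
abbrev Cell {R A : Type*} [CommRing R] [Ring A] [Algebra R A] (D : CellDatum R A) (l : D.Λ) :
    Type _ :=
  D.Std l → R

/-- The structure coefficients `r(a; t, v)`, see `coef_spec`. -/
noncomputable def coef {R A : Type*} [CommRing R] [Ring A] [Algebra R A] (D : CellDatum R A)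
    (l : D.Λ) (a : A) (t v : D.Std l) : R :=
  D.c.repr (D.c ⟨l, t, t⟩ * a) ⟨l, t, v⟩

theorem repr_gt {R A : Type*} [CommRing R] [Ring A] [Algebra R A] (D : CellDatum R A)
    (l : D.Λ) (y : A) (hy : y ∈ D.gt l) (s v : D.Std l) : D.c.repr y ⟨l, s, v⟩ = 0 := by
  classical
  unfold gt cellSpan at hy
  induction hy using Submodule.span_induction with
  | mem y hy =>
    obtain ⟨i, hi, rfl⟩ := hy
    rw [Module.Basis.repr_self, Finsupp.single_apply, if_neg]
    rintro rfl
    exact lt_irrefl _ hi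
  | zero => simp
  | add y z _ _ h1 h2 => simp [h1, h2]
  | smul a y _ h => simp [h]

theorem coef_eq {R A : Type*} [CommRing R] [Ring A] [Algebra R A] (D : CellDatum R A)
    (l : D.Λ) (a : A) (s t : D.Std l) (r : D.Std l → R)
    (h : D.c ⟨l, s, t⟩ * a - ∑ v, r v • D.c ⟨l, s, v⟩ ∈ D.gt l) (v : D.Std l) :
    D.c.repr (D.c ⟨l, s, t⟩ * a) ⟨l, s, v⟩ = r v := by
  classical
  have h1 := D.repr_gt l _ h s v
  rw [map_sub, Finsupp.sub_apply, sub_eq_zero] at h1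
  rw [h1, map_sum, Finsupp.finsetSum_apply, Finset.sum_eq_single v]
  · simp
  · intro b _ hb
    simp only [map_smul, Module.Basis.repr_self, Finsupp.smul_apply, smul_eq_mul]
    rw [Finsupp.single_apply, if_neg, mul_zero]
    intro hh
    simp only [Sigma.mk.injEq, heq_eq_eq, Prod.mk.injEq, true_and] at hh
    exact hb hh
  · simp

theorem coef_spec {R A : Type*} [CommRing R] [Ring A] [Algebra R A] (D : CellDatum R A)
    (l : D.Λ) (a : A) (s t : D.Std l) :
    D.c ⟨l, s, t⟩ * a - ∑ v, D.coef l a t v • D.c ⟨l, s, v⟩ ∈ D.gt l := by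
  obtain ⟨r, hr⟩ := D.mul_mem l t a
  have : ∀ v, D.coef l a t v = r v := fun v => D.coef_eq l a t t r (hr t) v
  simp only [this]
  exact hr s

theorem gt_mul {R A : Type*} [CommRing R] [Ring A] [Algebra R A] (D : CellDatum R A)
    (l : D.Λ) (y a : A) (hy : y ∈ D.gt l) : y * a ∈ D.gt l := by
  unfold gt cellSpan at hy
  induction hy using Submodule.span_induction with
  | mem y hy =>
    obtain ⟨⟨m, s, t⟩, hi, rfl⟩ := hy
    have h1 := D.coef_spec m a s t
    have h2 : D.gt m ≤ D.gt l := by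
      apply Submodule.span_mono
      apply Set.image_mono
      intro i hi'
      exact lt_trans (show l < m from hi) hi'
    have h3 : ∑ v, D.coef m a t v • D.c ⟨m, s, v⟩ ∈ D.gt l := by
      apply Submodule.sum_mem
      intro v _
      apply Submodule.smul_mem
      apply Submodule.subset_span
      exact ⟨⟨m, s, v⟩, hi, rfl⟩
    have h4 := Submodule.add_mem _ (h2 h1) h3
    simpa using h4
  | zero => simp
  | add y z _ _ h1 h2 =>
    rw [add_mul]
    exact Submodule.add_mem _ h1 h2
  | smul b y _ h =>
    rw [smul_mul_assoc]
    exact Submodule.smul_mem _ _ h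

theorem coef_one {R A : Type*} [CommRing R] [Ring A] [Algebra R A] (D : CellDatum R A)
    [DecidableEq R] (l : D.Λ) [DecidableEq (D.Std l)] (t v : D.Std l) :
    D.coef l 1 t v = if t = v then 1 else 0 := by
  apply D.coef_eq l 1 t t (fun v => if t = v then 1 else 0)
  simp

theorem coef_mul {R A : Type*} [CommRing R] [Ring A] [Algebra R A] (D : CellDatum R A)
    (l : D.Λ) (a b : A) (t v : D.Std l) :
    D.coef l (a * b) t v = ∑ w, D.coef l a t w * D.coef l b w v := by
  apply D.coef_eq l (a * b) t t (fun v => ∑ w, D.coef l a t w * D.coef l b w v)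
  have h1 := D.gt_mul l _ b (D.coef_spec l a t t)
  have h2 : ∑ w, D.coef l a t w •
      (D.c ⟨l, t, w⟩ * b - ∑ v, D.coef l b w v • D.c ⟨l, t, v⟩) ∈ D.gt l :=
    Submodule.sum_mem _ fun w _ => Submodule.smul_mem _ _ (D.coef_spec l b t w)
  have h3 := Submodule.add_mem _ h1 h2
  convert h3 using 1
  simp only [sub_mul, Finset.sum_mul, smul_sub, Finset.sum_sub_distrib, Finset.smul_sum,
    Finset.sum_smul, smul_mul_assoc, mul_smul, mul_assoc]
  rw [Finset.sum_comm]
  abel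

/-- The right `A`-module structure of the cell module: `c_t · a = ∑ v, r(a; t, v) c_v`. -/
noncomputable def cellRep {R A : Type*} [CommRing R] [Ring A] [Algebra R A] (D : CellDatum R A)
    (l : D.Λ) : RightRep R A (D.Cell l) :=
  AlgHom.ofLinearMap
    { toFun := fun a => MulOpposite.op
        (Matrix.vecMulLinear (Matrix.of (D.coef l a)))
      map_add' := by
        intro a b
        apply MulOpposite.unop_injective
        ext x v
        simp [coef, mul_add, Matrix.vecMul, dotProduct, Finset.sum_add_distrib]
      map_smul' := by
        intro r a
        apply MulOpposite.unop_injective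
        ext x v
        simp [coef, Matrix.vecMul, dotProduct, Finset.mul_sum, mul_left_comm] }
    (by
      classical
      apply MulOpposite.unop_injective
      apply LinearMap.ext
      intro x
      have : Matrix.of (D.coef l 1) = 1 := by
        ext t v
        rw [Matrix.of_apply, D.coef_one, Matrix.one_apply]
      simp [this])
    (by
      intro a b
      apply MulOpposite.unop_injective
      apply LinearMap.ext
      intro x
      have : Matrix.of (D.coef l (a * b)) = Matrix.of (D.coef l a) * Matrix.of (D.coef l b) := by
        ext t v
        rw [Matrix.of_apply, D.coef_mul, Matrix.mul_apply]
        rfl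
      simp [this, Matrix.vecMul_vecMul])

theorem cellRep_single {R A : Type*} [CommRing R] [Ring A] [Algebra R A] (D : CellDatum R A)
    (l : D.Λ) [DecidableEq (D.Std l)] (t : D.Std l) (a : A) :
    (D.cellRep l).act (Pi.single t 1) a = ∑ v, D.coef l a t v • Pi.single v 1 := by
  ext v
  simp [cellRep, RightRep.act, Pi.single_apply]

/-- `A^{⊵ l} / A^{▷ l}`. -/
abbrev Layer {R A : Type*} [CommRing R] [Ring A] [Algebra R A] (D : CellDatum R A) (l : D.Λ) :
    Type _ :=
  D.ge l ⧸ (D.gt l).submoduleOf (D.ge l)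

/-- `α` is an isomorphism of `A`-`A`-bimodules from `A^{⊵ l} / A^{▷ l}` to `Δ(l)^* ⊗ Δ(l)`.
Here `Δ(l)^*` is `Δ(l)` with the left action `a x = x a^*`. -/
def IsBimoduleIso {R A : Type*} [CommRing R] [Ring A] [Algebra R A] (D : CellDatum R A) (l : D.Λ)
    (α : D.Layer l ≃ₗ[R] D.Cell l ⊗[R] D.Cell l) : Prop :=
  ∀ (a b : A) (x y : D.ge l), (y : A) = a * x * b →
    α (Submodule.Quotient.mk y) =
      TensorProduct.map ((D.cellRep l (D.inv a)).unop) ((D.cellRep l b).unop)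
        (α (Submodule.Quotient.mk x))

end CellDatum

/-- An order preserving cell filtration `0 = N 0 ⊆ N 1 ⊆ ⋯ ⊆ N n = Δ_B(ν)` of the restriction of the
cell module `Δ_B(ν)` along `ι : A → B`, with fixed isomorphisms `N (j+1) / N j ≅ Δ_A(label j)`
and `label 0 ▷ label 1 ▷ ⋯`. -/
structure CellFiltration {R : Type*} {A B : Type*} [CommRing R] [Ring A] [Algebra R A] [Ring B]
    [Algebra R B] (DA : CellDatum R A) (DB : CellDatum R B) (ι : A →ₐ[R] B) (ν : DB.Λ) where
  n : ℕ
  N : Fin (n + 1) → Submodule R (DB.Cell ν)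
  N_zero : N 0 = ⊥
  N_last : N (Fin.last n) = ⊤
  N_mono : ∀ j : Fin n, N j.castSucc ≤ N j.succ
  N_stable : ∀ j, RightRep.Stable ((DB.cellRep ν).comp ι) (N j)
  label : Fin n → DA.Λ
  label_anti : StrictAnti label
  iso : ∀ j : Fin n, (N j.succ ⧸ (N j.castSucc).submoduleOf (N j.succ)) ≃ₗ[R] DA.Cell (label j)
  iso_mem : ∀ j : Fin n, (iso j : _ →ₗ[R] _) ∈
    RightRep.hom
      (RightRep.subquotient ((DB.cellRep ν).comp ι) (N j.succ) (N j.castSucc)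
        (N_stable j.succ) (N_stable j.castSucc))
      (DA.cellRep (label j))

/-! ### Towers of diagram algebras -/

/-- A tower of diagram algebras over the domain `R` with field of fractions `F`. -/
structure DiagramTower (R : Type u) (F : Type uF) [CommRing R] [IsDomain R] [Field F] [Algebra R F]
    [IsFractionRing R F] where
  /-- the increasing sequence of algebras, with its inclusions -/
  A : ℕ → Type v
  [ring : ∀ r, Ring (A r)]
  [algebra : ∀ r, Algebra R (A r)]
  incl : ∀ {s r : ℕ}, s ≤ r → (A s →ₐ[R] A r)
  incl_injective : ∀ {s r : ℕ} (h : s ≤ r), Function.Injective (incl h)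
  incl_refl : ∀ (r : ℕ) (a : A r), incl (le_refl r) a = a
  incl_trans : ∀ {q s r : ℕ} (h₁ : q ≤ s) (h₂ : s ≤ r) (a : A q),
    incl h₂ (incl h₁ a) = incl (h₁.trans h₂) a
  /-- the cellular structures, with consistent involutions -/
  cell : ∀ r, CellDatum.{u, v, w, x} R (A r)
  incl_inv : ∀ {s r : ℕ} (h : s ≤ r) (a : A s), incl h ((cell s).inv a) = (cell r).inv (incl h a)
  /-- `A 0 = R` -/
  zero_bijective : Function.Bijective (algebraMap R (A 0))
  /-- cyclic cellularity, with fixed generators `δ` of the cell modules -/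
  δ : ∀ (r : ℕ) (l : (cell r).Λ), (cell r).Cell l
  δ_generates : ∀ (r : ℕ) (l : (cell r).Λ) (y : (cell r).Cell l),
    ∃ a, ((cell r).cellRep l).act (δ r l) a = y
  /-- fixed bimodule isomorphisms `α` -/
  α : ∀ (r : ℕ) (l : (cell r).Λ),
    (cell r).Layer l ≃ₗ[R] (cell r).Cell l ⊗[R] (cell r).Cell l
  α_bimodule : ∀ (r : ℕ) (l : (cell r).Λ), (cell r).IsBimoduleIso l (α r l)
  /-- fixed self-adjoint lifts `m` of `α⁻¹ (δ^* ⊗ δ)` -/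
  m : ∀ (r : ℕ) (l : (cell r).Λ), (cell r).ge l
  α_m : ∀ (r : ℕ) (l : (cell r).Λ), α r l (Submodule.Quotient.mk (m r l)) = δ r l ⊗ₜ[R] δ r l
  m_inv : ∀ (r : ℕ) (l : (cell r).Λ), (cell r).inv (m r l) = (m r l : A r)
  /-- split semisimplicity over the field of fractions -/
  semisimple : ∀ r, IsSplitSemisimple F (F ⊗[R] A r)
  /-- restriction-coherence, with fixed filtrations -/
  filt : ∀ (r : ℕ) (ν : (cell (r + 1)).Λ),
    CellFiltration (cell r) (cell (r + 1)) (incl (Nat.le_succ r)) ν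
  /-- the branching factors: `δ(ν) d_{l → ν}` lies in the step of the filtration that belongs to
  `l`, and represents the generator `δ(l)` of the subquotient `Δ(l)` -/
  d : ∀ (r : ℕ) (_l : (cell r).Λ) (_ν : (cell (r + 1)).Λ), A (r + 1)
  d_spec : ∀ (r : ℕ) (ν : (cell (r + 1)).Λ) (j : Fin (filt r ν).n),
    ∃ h : ((cell (r + 1)).cellRep ν).act (δ (r + 1) ν) (d r ((filt r ν).label j) ν) ∈
        (filt r ν).N j.succ,
      (filt r ν).iso j (Submodule.Quotient.mk ⟨_, h⟩) = δ r ((filt r ν).label j)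
  /-- compatibility: existence of the `u`-branching factors, for each edge `l → ν` -/
  compatible : ∀ (r : ℕ) (ν : (cell (r + 1)).Λ) (j : Fin (filt r ν).n), ∃ e : A (r + 1),
    (m (r + 1) ν : A (r + 1)) * d r ((filt r ν).label j) ν =
      (cell (r + 1)).inv e * incl (Nat.le_succ r) (m r ((filt r ν).label j) : A r)
  /-- the involutive automorphisms `flip r` of `A r` -/
  flip : ∀ r, A r ≃ₐ[R] A r
  flip_flip : ∀ (r : ℕ) (a : A r), flip r (flip r a) = a
  flip_commute : ∀ {s r : ℕ} (h : s ≤ r) (a : A s) (b : A (r - s)),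
    Commute (incl h a) (flip r (incl (Nat.sub_le r s) b))

attribute [instance] DiagramTower.ring DiagramTower.algebra

namespace DiagramTower

/-- The edge relation `l → ν` of the branching diagram: `Δ(l)` is a subquotient of the cell
filtration of the restriction of `Δ(ν)`. -/
def Edge {R F : Type*} [CommRing R] [IsDomain R] [Field F] [Algebra R F] [IsFractionRing R F]
    (T : DiagramTower R F) {r : ℕ} (l : (T.cell r).Λ) (ν : (T.cell (r + 1)).Λ) : Prop :=
  ∃ j, (T.filt r ν).label j = l

/-- Paths `t(0) → t(1) → ⋯ → t(r)` in the branching diagram, i.e. elements of `Std_r`. -/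
structure Path {R F : Type*} [CommRing R] [IsDomain R] [Field F] [Algebra R F]
    [IsFractionRing R F] (T : DiagramTower R F) (r : ℕ) where
  vertex : ∀ k, k ≤ r → (T.cell k).Λ
  edge : ∀ k (h : k + 1 ≤ r), T.Edge (vertex k (Nat.le_of_succ_le h)) (vertex (k + 1) h)

/-- The endpoint of a path; `Std_r(ν)` consists of the paths with endpoint `ν`. -/
def Path.last {R F : Type*} [CommRing R] [IsDomain R] [Field F] [Algebra R F]
    [IsFractionRing R F] {T : DiagramTower R F} {r : ℕ} (t : T.Path r) : (T.cell r).Λ :=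
  t.vertex r (le_refl r)

/-- The truncation `t_{[0, s]}`. -/
def Path.trunc {R F : Type*} [CommRing R] [IsDomain R] [Field F] [Algebra R F]
    [IsFractionRing R F] {T : DiagramTower R F} {r : ℕ} (t : T.Path r) {s : ℕ} (h : s ≤ r) :
    T.Path s where
  vertex k hk := t.vertex k (hk.trans h)
  edge k hk := t.edge k (hk.trans h)

/-- The dominance order on paths: `t.Dominates t'` means `t ⊵ t'`. -/
def Path.Dominates {R F : Type*} [CommRing R] [IsDomain R] [Field F] [Algebra R F]
    [IsFractionRing R F] {T : DiagramTower R F} {r : ℕ} (t t' : T.Path r) : Prop :=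
  ∀ k (h : k ≤ r), t'.vertex k h ≤ t.vertex k h

/-- `t` is maximal, for the dominance order, among the paths with the same endpoint. -/
def Path.IsMaximal {R F : Type*} [CommRing R] [IsDomain R] [Field F] [Algebra R F]
    [IsFractionRing R F] {T : DiagramTower R F} {r : ℕ} (t : T.Path r) : Prop :=
  ∀ t' : T.Path r, t'.last = t.last → t'.Dominates t → t' = t

/-- `d_t = d_{t(r-1) → t(r)} ⋯ d_{t(0) → t(1)}`. -/
def Path.d {R F : Type*} [CommRing R] [IsDomain R] [Field F] [Algebra R F]
    [IsFractionRing R F] {T : DiagramTower R F} : {r : ℕ} → T.Path r → T.A r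
  | 0, _ => 1
  | r + 1, t =>
      T.d r (t.vertex r (Nat.le_succ r)) t.last *
        T.incl (Nat.le_succ r) (Path.d (t.trunc (Nat.le_succ r)))

/-- The Murphy basis element of `Δ_r(ν)` attached to a path with endpoint `ν`, i.e. `m_ν d_t`
modulo `A_r^{▷ ν}`, where `(m_ν A_r + A_r^{▷ ν}) / A_r^{▷ ν}` is identified with `Δ_r(ν)` by
`m_ν ↦ δ(ν)`. -/
noncomputable def murphy {R F : Type*} [CommRing R] [IsDomain R] [Field F] [Algebra R F]
    [IsFractionRing R F] (T : DiagramTower R F) {r : ℕ} (ν : (T.cell r).Λ) (t : T.Path r) :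
    (T.cell r).Cell ν :=
  ((T.cell r).cellRep ν).act (T.δ r ν) t.d

/-- `Δ(ν; ▷ l)`: the span of the Murphy basis elements `m_t`, `t ∈ Std_r(ν)`, `t(s) ▷ l`. -/
def aboveSpan {R F : Type*} [CommRing R] [IsDomain R] [Field F] [Algebra R F]
    [IsFractionRing R F] (T : DiagramTower R F) {s r : ℕ} (h : s ≤ r) (l : (T.cell s).Λ)
    (ν : (T.cell r).Λ) : Submodule R ((T.cell r).Cell ν) :=
  Submodule.span R {y | ∃ t : T.Path r, t.last = ν ∧ l < t.vertex s h ∧ y = T.murphy ν t}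

/-- `Δ(ν; t₀)` for a path `t₀ ∈ Std_s(l)`: the span of the Murphy basis elements of the paths in
`Std_r(ν)` of the form `t₀ ∘ t`, i.e. whose truncation at `s` is `t₀`. -/
def throughSpan {R F : Type*} [CommRing R] [IsDomain R] [Field F] [Algebra R F]
    [IsFractionRing R F] (T : DiagramTower R F) {s r : ℕ} (h : s ≤ r) (t₀ : T.Path s)
    (ν : (T.cell r).Λ) : Submodule R ((T.cell r).Cell ν) :=
  Submodule.span R {y | ∃ t : T.Path r, t.last = ν ∧ t.trunc h = t₀ ∧ y = T.murphy ν t}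

/-- The subalgebra `A_r ∩ A_s'` of the elements of `A_r` that commute with `A_s`. -/
def commutant {R F : Type*} [CommRing R] [IsDomain R] [Field F] [Algebra R F]
    [IsFractionRing R F] (T : DiagramTower R F) {s r : ℕ} (h : s ≤ r) : Subalgebra R (T.A r) :=
  Subalgebra.centralizer R (Set.range (T.incl h))

/-- The homomorphism `f_r ∘ f_{r-s} : A_{r-s} → A_r ∩ A_s'`. -/
def shift {R F : Type*} [CommRing R] [IsDomain R] [Field F] [Algebra R F]
    [IsFractionRing R F] (T : DiagramTower R F) {s r : ℕ} (h : s ≤ r) :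
    T.A (r - s) →ₐ[R] T.commutant h :=
  AlgHom.codRestrict
    ((T.flip r : T.A r →ₐ[R] T.A r).comp
      ((T.incl (Nat.sub_le r s)).comp (T.flip (r - s) : T.A (r - s) →ₐ[R] T.A (r - s))))
    (T.commutant h)
    (by
      intro b
      rw [commutant, Subalgebra.mem_centralizer_iff]
      rintro _ ⟨a, rfl⟩
      exact T.flip_commute h a (T.flip (r - s) b))

/-- `Δ_r(ν)` as a right module over `A_r ∩ A_s'`. -/
noncomputable def commutantRep {R F : Type*} [CommRing R] [IsDomain R] [Field F] [Algebra R F]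
    [IsFractionRing R F] (T : DiagramTower R F) {s r : ℕ} (h : s ≤ r) (ν : (T.cell r).Λ) :
    RightRep R (T.commutant h) ((T.cell r).Cell ν) :=
  ((T.cell r).cellRep ν).comp (T.commutant h).val

/-- The underlying module `(Δ(ν; t₀) + Δ(ν; ▷ l)) / Δ(ν; ▷ l)` of the skew cell module
`Δ(ν ∖ l)`, where `l` is the endpoint of the path `t₀`. -/
abbrev Skew {R F : Type*} [CommRing R] [IsDomain R] [Field F] [Algebra R F]
    [IsFractionRing R F] (T : DiagramTower R F) {s r : ℕ} (h : s ≤ r) (t₀ : T.Path s)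
    (ν : (T.cell r).Λ) : Type _ :=
  ↥(T.throughSpan h t₀ ν ⊔ T.aboveSpan h t₀.last ν) ⧸
    (T.aboveSpan h t₀.last ν).submoduleOf (T.throughSpan h t₀ ν ⊔ T.aboveSpan h t₀.last ν)

/-- The skew cell module, as a right module over `A_{r-s}`, via `f_r ∘ f_{r-s}`. It is defined as
soon as the two submodules are stable under `A_r ∩ A_s'`. -/
noncomputable def skewRep {R F : Type*} [CommRing R] [IsDomain R] [Field F] [Algebra R F]
    [IsFractionRing R F] (T : DiagramTower R F) {s r : ℕ} (h : s ≤ r) (t₀ : T.Path s)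
    (ν : (T.cell r).Λ)
    (hU : (T.commutantRep h ν).Stable (T.throughSpan h t₀ ν ⊔ T.aboveSpan h t₀.last ν))
    (hW : (T.commutantRep h ν).Stable (T.aboveSpan h t₀.last ν)) :
    RightRep R (T.A (r - s)) (T.Skew h t₀ ν) :=
  (RightRep.subquotient (T.commutantRep h ν) _ _ hU hW).comp (T.shift h)

/-! Extension of scalars to the field of fractions. -/

/-- `A_r^F`. -/
abbrev AF {R F : Type*} [CommRing R] [IsDomain R] [Field F] [Algebra R F]
    [IsFractionRing R F] (T : DiagramTower R F) (r : ℕ) : Type _ :=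
  F ⊗[R] T.A r

/-- The homomorphism `φ_{r,s} : A_s^F ⊗ A_{r-s}^F → A_r^F`, `a ⊗ b ↦ a f_r(f_{r-s}(b))`. -/
noncomputable def φ {R F : Type*} [CommRing R] [IsDomain R] [Field F] [Algebra R F]
    [IsFractionRing R F] (T : DiagramTower R F) {s r : ℕ} (h : s ≤ r) :
    T.AF s ⊗[F] T.AF (r - s) →ₐ[F] T.AF r :=
  Algebra.TensorProduct.lift
    (Algebra.TensorProduct.map (AlgHom.id F F) (T.incl h))
    (Algebra.TensorProduct.map (AlgHom.id F F) ((T.commutant h).val.comp (T.shift h)))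
    (by
      intro x y
      induction x using TensorProduct.induction_on with
      | zero => simp
      | add x x' hx hx' => rw [map_add]; exact hx.add_left hx'
      | tmul p a =>
        induction y using TensorProduct.induction_on with
        | zero => simp
        | add y y' hy hy' => rw [map_add]; exact hy.add_right hy'
        | tmul q b =>
          have := T.flip_commute h a (T.flip (r - s) b)
          change _ * _ = _ * _
          simp only [Algebra.TensorProduct.map_tmul, Algebra.TensorProduct.tmul_mul_tmul,
            AlgHom.id_apply]
          rw [mul_comm p q]
          congr 1)

/-- `Δ_r^F(ν)`, as a right module over `A_r^F`. -/
noncomputable def cellRepF {R F : Type*} [CommRing R] [IsDomain R] [Field F] [Algebra R F]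
    [IsFractionRing R F] (T : DiagramTower R F) {r : ℕ} (ν : (T.cell r).Λ) :
    RightRep F (T.AF r) (F ⊗[R] (T.cell r).Cell ν) :=
  RightRep.baseChange F ((T.cell r).cellRep ν)

end DiagramTower

/-! The spans occurring in the proposition are cut out of `Δ_r(ν)` by elements of `A_s`, and such
conditions are respected by everything that commutes with `A_s`. For an upper set `Γ` of cells of
`A_s`, the cell ideal of `Γ` becomes, over the semisimple algebra `A_s^F`, an ideal generated by a
central idempotent. Clearing denominators gives `e` in the ideal and `q ≠ 0` in `R` such that `e /
q` is its unit (`exists_isScaledUnit`). The key lemma `levelSpan_eq_scaledFixed` says that the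
Murphy elements of the paths with `t(s) ∈ Γ` span exactly the submodule on which `e` acts as `q`.
One inclusion comes from `m_ν d_{μ→ν} = u^* m_μ`, iterated along a path; the other is an induction
along the cell filtrations. Hence these spans are stable under `A_r ∩ A_s'` and are pure
`R`-submodules. For a single path `t₀`, `exists_isMatrixRow` provides elements `b x` of `A_s` which,
up to a scalar `q`, form a row of matrix units for the block of the endpoint, adapted to the Murphy
basis. Modulo `Δ(ν; ▷ l)`, the diagonal unit `b(m_{t₀})` acts as `q` on the Murphy elements through
`t₀`, and as `0` on those through other paths to `l`. This characterizes `Δ(ν; t₀) + Δ(ν; ▷ l)`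
(`through_sup_above_mem_iff`) and so proves its stability. Right multiplication by the diagonal unit
embeds the skew cell module in `Δ_r(ν)`, with image over `F` equal to `V ε`, where `V = Δ_r^F(ν)`
and `ε = b(m_{t₀}) / q`. The Hom isomorphism is then the usual `Hom(L ⊗ M, V) ≅ Hom(M, V ε)` for a
primitive idempotent `ε` belonging to `L` (`nonempty_hom_outer_equiv`). -/

/-! ### Right modules, and homomorphisms out of an outer tensor product. -/

namespace RightRep

section
variable {K A V : Type*} [CommRing K] [Ring A] [Algebra K A] [AddCommGroup V] [Module K V]
  (ρ : RightRep K A V)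

theorem act_mul (v : V) (a b : A) : ρ.act v (a * b) = ρ.act (ρ.act v a) b := by
  simp [act]

theorem act_one (v : V) : ρ.act v 1 = v := by
  simp [act]

theorem act_add (v : V) (a b : A) : ρ.act v (a + b) = ρ.act v a + ρ.act v b := by
  simp [act]

theorem act_sub (v : V) (a b : A) : ρ.act v (a - b) = ρ.act v a - ρ.act v b := by
  simp [act]

theorem act_smul (v : V) (k : K) (a : A) : ρ.act v (k • a) = k • ρ.act v a := by
  simp [act]

theorem act_zero (v : V) : ρ.act v 0 = 0 := by
  simp [act]

theorem add_act (v w : V) (a : A) : ρ.act (v + w) a = ρ.act v a + ρ.act w a := by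
  simp [act]

theorem sub_act (v w : V) (a : A) : ρ.act (v - w) a = ρ.act v a - ρ.act w a := by
  simp [act]

theorem smul_act (k : K) (v : V) (a : A) : ρ.act (k • v) a = k • ρ.act v a := by
  simp [act]

theorem zero_act (a : A) : ρ.act 0 a = 0 := by
  simp [act]

end

/-- If `V` is, as an `A`-module, controlled by a rank one family `b : L → A` at a vector `l` of `L`,
then homomorphisms from `L ⊗ M` to `V` are homomorphisms from `M` to the space `V · b(l)`, of which
`g : S → V` is a parametrization. -/
theorem nonempty_hom_outer_equiv {K A B L M V S : Type*} [CommRing K] [Ring A] [Algebra K A]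
    [Ring B] [Algebra K B] [AddCommGroup L] [Module K L] [AddCommGroup M] [Module K M]
    [AddCommGroup V] [Module K V] [AddCommGroup S] [Module K S]
    (ρ : RightRep K A L) (μ : RightRep K B M) (σ : RightRep K (A ⊗[K] B) V) (τ : RightRep K B S)
    (b : L →ₗ[K] A) (l : L) (g : S →ₗ[K] V) (hb : ∀ x, ρ.act l (b x) = x)
    (hσ : ∀ v x a, σ.act (σ.act v (b x ⊗ₜ 1)) (a ⊗ₜ 1) = σ.act v (b (ρ.act x a) ⊗ₜ 1))
    (hg : Function.Injective g) (hfix : ∀ y, σ.act (g y) (b l ⊗ₜ 1) = g y)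
    (hrange : ∀ v, σ.act v (b l ⊗ₜ 1) ∈ LinearMap.range g)
    (hequiv : ∀ y c, g (τ.act y c) = σ.act (g y) (1 ⊗ₜ c)) :
    Nonempty (hom (outer ρ μ) σ ≃ₗ[K] hom μ τ) := by
  let G := LinearEquiv.ofInjective g hg
  have hG : ∀ v, g (G.symm v) = v := fun v => by
    have := G.apply_symm_apply v
    exact congrArg Subtype.val this
  have hΦ : ∀ (Φ : hom (outer ρ μ) σ) (x : L) (y : M) (a : A) (c : B),
      Φ.1 (ρ.act x a ⊗ₜ μ.act y c) = σ.act (Φ.1 (x ⊗ₜ y)) (a ⊗ₜ c) := fun Φ x y a c => by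
    rw [← outer_act]
    exact Φ.2 _ _
  have hmem : ∀ (Φ : hom (outer ρ μ) σ) (y : M), Φ.1 (l ⊗ₜ y) ∈ LinearMap.range g := by
    intro Φ y
    -- Since `l · b l = l`, the vector `Φ (l ⊗ y)` is fixed by `b l ⊗ 1`.
    have := hΦ Φ l y (b l) 1
    rw [hb, act_one] at this
    rw [this]
    exact hrange _
  let fwd : hom (outer ρ μ) σ →ₗ[K] hom μ τ :=
    { toFun := fun Φ => ⟨G.symm.toLinearMap ∘ₗ
          LinearMap.codRestrict (LinearMap.range g) (Φ.1 ∘ₗ TensorProduct.mk K L M l) (hmem Φ), by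
          intro y c
          apply hg
          rw [hequiv]
          simp only [LinearMap.comp_apply, LinearEquiv.coe_coe, hG]
          have := hΦ Φ l y 1 c
          rwa [act_one] at this⟩
      map_add' := by
        intro Φ Ψ
        ext y
        apply hg
        simp [hG]
        rfl
      map_smul' := by
        intro k Φ
        ext y
        apply hg
        simp [hG]
        rfl }
  have hfwd : ∀ Φ y, g ((fwd Φ).1 y) = Φ.1 (l ⊗ₜ y) := fun Φ y => by
    simp [fwd, hG]
    rfl
  have hinj : Function.Injective fwd := by
    intro Φ Ψ h
    apply Subtype.ext
    apply TensorProduct.ext'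
    intro x y
    have h1 := hΦ Φ l y (b x) 1
    have h2 := hΦ Ψ l y (b x) 1
    rw [hb, act_one] at h1 h2
    rw [h1, h2, ← hfwd, ← hfwd, h]
  have hsurj : Function.Surjective fwd := by
    intro ψ
    -- As `x = l · b x`, this is the only possible value at `x ⊗ y` of a homomorphism that restricts
    -- to `g ∘ ψ` on `l ⊗ M`.
    let β : L →ₗ[K] M →ₗ[K] V := LinearMap.mk₂ K (fun x y => σ.act (g (ψ.1 y)) (b x ⊗ₜ 1))
      (by intro x x' y; rw [map_add, TensorProduct.add_tmul, act_add])
      (by intro k x y; rw [map_smul, ← TensorProduct.smul_tmul', act_smul])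
      (by intro x y y'; rw [map_add, map_add, add_act])
      (by intro k x y; rw [map_smul, map_smul, smul_act])
    have hβ : ∀ x y, TensorProduct.lift β (x ⊗ₜ y) = σ.act (g (ψ.1 y)) (b x ⊗ₜ 1) :=
      fun x y => rfl
    refine ⟨⟨TensorProduct.lift β, ?_⟩, ?_⟩
    · intro z w
      induction z using TensorProduct.induction_on with
      | zero => simp only [zero_act, map_zero]
      | add z z' hz hz' => rw [add_act, map_add, map_add, add_act, hz, hz']
      | tmul x y =>
        induction w using TensorProduct.induction_on with
        | zero => simp only [act_zero, map_zero]
        | add w w' hw hw' => rw [act_add, map_add, act_add, hw, hw']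
        | tmul a c =>
          have h1 := ψ.2 y c
          rw [outer_act, hβ, hβ, h1, hequiv, ← act_mul, ← act_mul,
            Algebra.TensorProduct.tmul_mul_tmul, Algebra.TensorProduct.tmul_mul_tmul, one_mul,
            mul_one, one_mul, ← mul_one (b (ρ.act x a)), ← one_mul c,
            ← Algebra.TensorProduct.tmul_mul_tmul, act_mul, ← hσ, ← act_mul, ← act_mul,
            Algebra.TensorProduct.tmul_mul_tmul, Algebra.TensorProduct.tmul_mul_tmul]
          simp
    · apply Subtype.ext
      ext y
      apply hg
      rw [hfwd]
      exact hfix _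
  exact ⟨LinearEquiv.ofBijective fwd ⟨hinj, hsurj⟩⟩

end RightRep

/-! ### Semisimplicity and clearing of denominators. -/

theorem IsSplitSemisimple.isSemisimpleRing {F A : Type*} [Field F] [Ring A] [Algebra F A]
    (h : IsSplitSemisimple F A) : IsSemisimpleRing A := by
  obtain ⟨n, d, ⟨e⟩⟩ := h
  exact e.symm.toRingEquiv.isSemisimpleRing

theorem Submodule.exists_smul_eq_one_tmul {R F V : Type*} [CommRing R] [IsDomain R] [Field F] [Algebra R F]
    [IsFractionRing R F] [AddCommGroup V] [Module R V] (P : Submodule R V) {z : F ⊗[R] V}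
    (hz : z ∈ P.baseChange F) : ∃ q : R, q ≠ 0 ∧ ∃ y ∈ P, algebraMap R F q • z = 1 ⊗ₜ[R] y := by
  rw [Submodule.baseChange_eq_span] at hz
  induction hz using Submodule.span_induction with
  | mem z hz =>
    obtain ⟨y, hy, rfl⟩ := hz
    exact ⟨1, one_ne_zero, y, hy, by simp⟩
  | zero => exact ⟨1, one_ne_zero, 0, P.zero_mem, by simp⟩
  | add z z' _ _ h h' =>
    obtain ⟨q, hq, y, hy, e⟩ := h
    obtain ⟨q', hq', y', hy', e'⟩ := h'
    refine ⟨q * q', mul_ne_zero hq hq', q' • y + q • y',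
      P.add_mem (P.smul_mem _ hy) (P.smul_mem _ hy'), ?_⟩
    rw [smul_add, map_mul, mul_comm, mul_smul, e, mul_comm, mul_smul, e', TensorProduct.tmul_add,
      algebraMap_smul, algebraMap_smul, TensorProduct.tmul_smul, TensorProduct.tmul_smul]
  | smul k z _ h =>
    obtain ⟨q, hq, y, hy, e⟩ := h
    obtain ⟨a, b, hb, rfl⟩ := IsFractionRing.div_surjective (A := R) k
    have hb0 : b ≠ 0 := nonZeroDivisors.ne_zero hb
    have hb1 : algebraMap R F b ≠ 0 := by simpa using hb0
    refine ⟨b * q, mul_ne_zero hb0 hq, a • y, P.smul_mem _ hy, ?_⟩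
    rw [TensorProduct.tmul_smul, ← e, ← algebraMap_smul F a, smul_smul, smul_smul]
    congr 1
    rw [map_mul]
    field_simp

/-! ### Cell ideals and their units. -/

namespace CellDatum

section
variable {R A : Type*} [CommRing R] [Ring A] [Algebra R A] (D : CellDatum R A)

theorem cellSpan_le {Γ : Set D.Λ} {P : Submodule R A}
    (h : ∀ i : Σ l : D.Λ, D.Std l × D.Std l, i.1 ∈ Γ → D.c i ∈ P) : cellSpan R D.c Γ ≤ P := by
  apply Submodule.span_le.2
  rintro _ ⟨i, hi, rfl⟩
  exact h i hi

theorem basis_mem_cellSpan {Γ : Set D.Λ} {l : D.Λ} (hl : l ∈ Γ) (s t : D.Std l) :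
    D.c ⟨l, s, t⟩ ∈ cellSpan R D.c Γ :=
  Submodule.subset_span ⟨_, hl, rfl⟩

theorem cellSpan_mono {Γ Γ' : Set D.Λ} (h : Γ ⊆ Γ') :
    cellSpan R D.c Γ ≤ cellSpan R D.c Γ' :=
  Submodule.span_mono (Set.image_mono fun _ hi => h hi)

theorem gt_le_cellSpan {Γ : Set D.Λ} (hΓ : IsUpperSet Γ) {l : D.Λ} (hl : l ∈ Γ) :
    D.gt l ≤ cellSpan R D.c Γ :=
  D.cellSpan_mono fun _ hm => hΓ (le_of_lt hm) hl

theorem mem_cellSpan_iff {Γ : Set D.Λ} {y : A} :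
    y ∈ cellSpan R D.c Γ ↔ ∀ i, i.1 ∉ Γ → D.c.repr y i = 0 := by
  unfold cellSpan
  rw [Module.Basis.mem_span_image]
  constructor
  · intro h i hi
    by_contra hne
    exact hi (h (Finsupp.mem_support_iff.2 hne))
  · intro h i hi
    by_contra hne
    exact Finsupp.mem_support_iff.1 hi (h i hne)

/-- The ideal is spanned by part of a basis, so the quotient is torsion-free. This makes it possible
to divide by the scalars that arise from denominators. -/
theorem mem_cellSpan_of_smul_mem [IsDomain R] {Γ : Set D.Λ} {q : R} (hq : q ≠ 0) {y : A}
    (h : q • y ∈ cellSpan R D.c Γ) : y ∈ cellSpan R D.c Γ := by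
  rw [mem_cellSpan_iff] at h ⊢
  intro i hi
  simpa [hq] using h i hi

theorem mul_mem_cellSpan {Γ : Set D.Λ} (hΓ : IsUpperSet Γ) {y : A} (a : A)
    (hy : y ∈ cellSpan R D.c Γ) : y * a ∈ cellSpan R D.c Γ := by
  revert y
  change cellSpan R D.c Γ ≤ (cellSpan R D.c Γ).comap (LinearMap.mulRight R a)
  apply D.cellSpan_le
  rintro ⟨l, s, t⟩ hl
  have h1 := D.gt_le_cellSpan hΓ hl (D.coef_spec l a s t)
  have h2 : ∑ v, D.coef l a t v • D.c ⟨l, s, v⟩ ∈ cellSpan R D.c Γ :=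
    Submodule.sum_mem _ fun v _ => Submodule.smul_mem _ _ (D.basis_mem_cellSpan hl s v)
  simpa using Submodule.add_mem _ h1 h2

theorem inv_mem_cellSpan {Γ : Set D.Λ} (hΓ : IsUpperSet Γ) {y : A}
    (hy : y ∈ cellSpan R D.c Γ) : D.inv y ∈ cellSpan R D.c Γ := by
  revert y
  change cellSpan R D.c Γ ≤ (cellSpan R D.c Γ).comap D.inv
  apply D.cellSpan_le
  rintro ⟨l, s, t⟩ hl
  have h1 := D.gt_le_cellSpan hΓ hl (D.inv_mem l s t)
  simpa using Submodule.add_mem _ h1 (D.basis_mem_cellSpan hl t s)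

theorem mul_mem_cellSpan' {Γ : Set D.Λ} (hΓ : IsUpperSet Γ) {y : A} (a : A)
    (hy : y ∈ cellSpan R D.c Γ) : a * y ∈ cellSpan R D.c Γ := by
  have h := D.inv_mem_cellSpan hΓ
    (D.mul_mem_cellSpan hΓ (D.inv a) (D.inv_mem_cellSpan hΓ hy))
  rwa [D.inv_mul, D.inv_inv, D.inv_inv] at h

/-! #### The action on a cell module -/

theorem cellRep_act_apply (l : D.Λ) (x : D.Cell l) (a : A) (v : D.Std l) :
    (D.cellRep l).act x a v = ∑ t, x t * D.coef l a t v := by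
  simp [cellRep, RightRep.act, Matrix.vecMul, dotProduct]

theorem coef_eq_zero_of_mem {Γ : Set D.Λ} (hΓ : IsUpperSet Γ) {l : D.Λ} (hl : l ∉ Γ) {y : A}
    (hy : y ∈ cellSpan R D.c Γ) (t v : D.Std l) : D.coef l y t v = 0 :=
  D.mem_cellSpan_iff.1 (D.mul_mem_cellSpan' hΓ _ hy) _ hl

theorem act_eq_zero_of_mem {Γ : Set D.Λ} (hΓ : IsUpperSet Γ) {l : D.Λ} (hl : l ∉ Γ) {y : A}
    (hy : y ∈ cellSpan R D.c Γ) (x : D.Cell l) : (D.cellRep l).act x y = 0 := by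
  ext v
  simp [cellRep_act_apply, D.coef_eq_zero_of_mem hΓ hl hy]

/-- Modulo `A^{▷ l}`, right multiplication on `A^{⊵ l}` is given by the structure coefficients of
the cell module. -/
theorem mul_mem_gt_of_act_eq_zero {l : D.Λ} {y : A} (hy : ∀ x, (D.cellRep l).act x y = 0)
    {z : A} (hz : z ∈ D.ge l) : z * y ∈ D.gt l := by
  classical
  have hc : ∀ t v, D.coef l y t v = 0 := by
    intro t v
    have := congrFun (hy (Pi.single t 1)) v
    rw [cellRep_act_apply] at this
    simpa [Pi.single_apply] using this
  revert z
  change cellSpan R D.c (Set.Ici l) ≤ (D.gt l).comap (LinearMap.mulRight R y)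
  apply D.cellSpan_le
  rintro ⟨m, s, t⟩ hm
  rcases eq_or_lt_of_le (show l ≤ m from hm) with rfl | hlt
  · simpa [hc] using D.coef_spec l y s t
  · exact D.gt_mul l _ y (D.basis_mem_cellSpan hlt s t)

/-- Here `φ` is the Gram matrix of the cellular bilinear form. The involution turns the right
multiplication rule for `c_{ts} c_{vv}` into a left rule for `c_{vv} c_{st}`, so modulo `A^{▷ l}`
only terms with second index `t` survive. -/
theorem exists_coef_form (l : D.Λ) : ∃ φ : D.Std l → D.Std l → R, ∀ s t v w,
    D.coef l (D.c ⟨l, s, t⟩) v w = open Classical in if t = w then φ v s else 0 := by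
  classical
  refine ⟨fun v s => D.coef l (D.c ⟨l, v, v⟩) s v, fun s t v w => ?_⟩
  have hu : IsUpperSet (Set.Ioi l) := isUpperSet_Ioi l
  have h1 := D.coef_spec l (D.c ⟨l, v, v⟩) t s
  have h2 : D.inv (D.c ⟨l, t, s⟩ * D.c ⟨l, v, v⟩ -
      ∑ u, D.coef l (D.c ⟨l, v, v⟩) s u • D.c ⟨l, t, u⟩) ∈ D.gt l := D.inv_mem_cellSpan hu h1
  rw [map_sub, D.inv_mul, map_sum] at h2
  have h3 : ∑ u, D.coef l (D.c ⟨l, v, v⟩) s u • (D.inv (D.c ⟨l, t, u⟩) - D.c ⟨l, u, t⟩) ∈ D.gt l :=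
    Submodule.sum_mem _ fun u _ => Submodule.smul_mem _ _ (D.inv_mem l t u)
  have h4 : D.inv (D.c ⟨l, v, v⟩) * (D.inv (D.c ⟨l, t, s⟩) - D.c ⟨l, s, t⟩) ∈ D.gt l :=
    D.mul_mem_cellSpan' hu _ (D.inv_mem l t s)
  have h5 : (D.inv (D.c ⟨l, v, v⟩) - D.c ⟨l, v, v⟩) * D.c ⟨l, s, t⟩ ∈ D.gt l :=
    D.mul_mem_cellSpan hu _ (D.inv_mem l v v)
  have h6 : D.c ⟨l, v, v⟩ * D.c ⟨l, s, t⟩ -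
      ∑ u, D.coef l (D.c ⟨l, v, v⟩) s u • D.c ⟨l, u, t⟩ ∈ D.gt l := by
    have := Submodule.add_mem _ (Submodule.sub_mem _ (Submodule.sub_mem _ h2 h4) h5) h3
    convert this using 1
    simp only [map_smul, smul_sub, Finset.sum_sub_distrib, mul_sub, sub_mul]
    abel
  have h7 := D.repr_gt l _ h6 v w
  rw [map_sub, Finsupp.sub_apply, sub_eq_zero] at h7
  change D.c.repr _ _ = _
  rw [h7, map_sum, Finsupp.finsetSum_apply]
  simp only [map_smul, Module.Basis.repr_self, Finsupp.smul_apply, smul_eq_mul,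
    Finsupp.single_apply, Sigma.mk.injEq, heq_eq_eq, Prod.mk.injEq, true_and]
  split_ifs with h <;> simp [h]

theorem coef_sum {ι : Type*} (l : D.Λ) (S : Finset ι) (k : ι → R) (y : ι → A) (t v : D.Std l) :
    D.coef l (∑ i ∈ S, k i • y i) t v = ∑ i ∈ S, k i * D.coef l (y i) t v := by
  simp [coef, Finset.mul_sum, Finsupp.finsetSum_apply]

theorem sub_sum_mem_gt {l : D.Λ} {y : A} (hy : y ∈ D.ge l) :
    y - ∑ p : D.Std l × D.Std l, D.c.repr y ⟨l, p⟩ • D.c ⟨l, p⟩ ∈ D.gt l := by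
  classical
  refine D.mem_cellSpan_iff.2 ?_
  rintro ⟨m, p⟩ hm
  rw [map_sub, map_sum, Finsupp.sub_apply, Finsupp.finsetSum_apply]
  simp only [map_smul, Module.Basis.repr_self, Finsupp.smul_apply, smul_eq_mul,
    Finsupp.single_apply]
  by_cases hml : l = m
  · subst hml
    simp
  · have h1 : D.c.repr y ⟨m, p⟩ = 0 := by
      refine D.mem_cellSpan_iff.1 hy _ fun hle => hm ?_
      exact lt_of_le_of_ne hle hml
    rw [h1]
    simp [hml]

/-! #### Scaled units of cell ideals -/

/-- `e / q` is a two-sided unit of the ideal spanned by the cells in `Γ`. -/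
structure IsScaledUnit (Γ : Set D.Λ) (e : A) (q : R) : Prop where
  mem : e ∈ cellSpan R D.c Γ
  ne_zero : q ≠ 0
  mul_right : ∀ y ∈ cellSpan R D.c Γ, y * e = q • y
  mul_left : ∀ y ∈ cellSpan R D.c Γ, e * y = q • y

variable {D}

/-- Both `e a` and `a e` lie in the ideal, so `e a e` equals `q • e a` as well as `q • a e`; then
`q` cancels. -/
theorem IsScaledUnit.comm [IsDomain R] {Γ : Set D.Λ} (hΓ : IsUpperSet Γ) {e : A} {q : R}
    (h : D.IsScaledUnit Γ e q) (a : A) : e * a = a * e := by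
  have h1 := h.mul_right _ (D.mul_mem_cellSpan hΓ a h.mem)
  have h2 := h.mul_left _ (D.mul_mem_cellSpan' hΓ a h.mem)
  rw [← mul_assoc, h1] at h2
  have h3 : q • (e * a - a * e) = 0 := by rw [smul_sub, h2, sub_self]
  have h4 : D.c.repr (e * a - a * e) = 0 := by
    have := congrArg D.c.repr h3
    rw [map_smul, map_zero] at this
    exact (smul_eq_zero.1 this).resolve_left h.ne_zero
  exact sub_eq_zero.1 (D.c.repr.map_eq_zero_iff.1 h4)

theorem IsScaledUnit.act_eq_smul {Γ : Set D.Λ} {e : A} {q : R} (h : D.IsScaledUnit Γ e q)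
    {l : D.Λ} (hl : l ∈ Γ) (x : D.Cell l) : (D.cellRep l).act x e = q • x := by
  classical
  ext v
  have : ∀ t, D.coef l e t v = if t = v then q else 0 := by
    intro t
    rw [coef, h.mul_right _ (D.basis_mem_cellSpan hl t t)]
    simp [Finsupp.single_apply]
  rw [cellRep_act_apply]
  simp [this, mul_comm]

theorem IsScaledUnit.mem_gt_of_act_eq_zero [IsDomain R] {l : D.Λ} {e : A} {q : R}
    (h : D.IsScaledUnit (Set.Ici l) e q) {y : A} (hy : y ∈ D.ge l)
    (h0 : ∀ x, (D.cellRep l).act x y = 0) : y ∈ D.gt l := by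
  apply D.mem_cellSpan_of_smul_mem h.ne_zero
  rw [← h.mul_left y hy]
  exact D.mul_mem_gt_of_act_eq_zero h0 h.mem

/-- Up to scaling, every rank one endomorphism of a cell module comes from `A^{⊵ l}`. -/
theorem IsScaledUnit.exists_rankOne {l : D.Λ} {e : A} {q : R}
    (h : D.IsScaledUnit (Set.Ici l) e q) (f : D.Cell l →ₗ[R] R) :
    ∃ b : D.Cell l →ₗ[R] A, (∀ x, b x ∈ D.ge l) ∧
      ∀ z x, (D.cellRep l).act z (b x) = (q * f z) • x := by
  classical
  obtain ⟨φ, hφ⟩ := D.exists_coef_form l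
  let g : D.Std l → D.Std l → R := fun s t => D.c.repr e ⟨l, s, t⟩
  -- As matrices, `φ g = q`: the coefficients of `e` at `l` form `q` times the inverse of the Gram
  -- matrix, because `e` acts on the cell module as `q`.
  have hg : ∀ v w, ∑ s, g s w * φ v s = if v = w then q else 0 := by
    intro v w
    have h1 : D.coef l e v w = if v = w then q else 0 := by
      have := congrFun (h.act_eq_smul (le_refl l) (Pi.single v 1)) w
      rw [cellRep_act_apply] at this
      simpa [Pi.single_apply, eq_comm] using this
    have h2 := D.coef_eq_zero_of_mem (isUpperSet_Ioi l) (Set.self_notMem_Ioi)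
      (D.sub_sum_mem_gt h.mem) v w
    have h3 : D.coef l e v w = ∑ p : D.Std l × D.Std l,
        D.c.repr e ⟨l, p⟩ * D.coef l (D.c ⟨l, p⟩) v w := by
      rw [← D.coef_sum, ← sub_eq_zero, ← h2]
      simp [coef, mul_sub]
    rw [← h1, h3, Fintype.sum_prod_type]
    simp [hφ, g]
  -- The vector `k = g f` solves `φ k = q f`, so the elements `∑ k_s x_t c_{st}` act by `z ↦ q f(z)
  -- x`.
  let k : D.Std l → R := fun s => ∑ v, g s v * f (Pi.single v 1)
  let b : D.Cell l →ₗ[R] A :=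
    { toFun := fun x => ∑ p : D.Std l × D.Std l, (k p.1 * x p.2) • D.c ⟨l, p⟩
      map_add' := by
        intro x y
        simp [mul_add, add_smul, Finset.sum_add_distrib]
      map_smul' := by
        intro r x
        simp [Finset.smul_sum, smul_smul, mul_left_comm] }
  refine ⟨b, fun x => Submodule.sum_mem _ fun p _ => Submodule.smul_mem _ _
    (D.basis_mem_cellSpan (le_refl l) _ _), fun z x => ?_⟩
  have hk : ∀ v, ∑ s, k s * φ v s = q * f (Pi.single v 1) := by
    intro v
    simp only [k, Finset.sum_mul]
    rw [Finset.sum_comm]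
    have : ∀ w, ∑ s, g s w * f (Pi.single w 1) * φ v s =
        (if v = w then q else 0) * f (Pi.single w 1) := by
      intro w
      rw [← hg, Finset.sum_mul]
      exact Finset.sum_congr rfl fun s _ => by ring
    simp [this]
  have hfz : f z = ∑ v, z v * f (Pi.single v 1) := by
    conv_lhs => rw [← Finset.univ_sum_single z, map_sum]
    refine Finset.sum_congr rfl fun v _ => ?_
    rw [← smul_eq_mul, ← map_smul, ← Pi.single_smul, smul_eq_mul, mul_one]
  ext w
  rw [cellRep_act_apply]
  have h4 : ∀ v, D.coef l (b x) v w = (q * f (Pi.single v 1)) * x w := by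
    intro v
    change D.coef l (∑ p : D.Std l × D.Std l, (k p.1 * x p.2) • D.c ⟨l, p⟩) v w = _
    rw [D.coef_sum, Fintype.sum_prod_type, ← hk, Finset.sum_mul]
    simp only [hφ]
    refine Finset.sum_congr rfl fun s _ => ?_
    simp
    ring
  simp only [h4, Pi.smul_apply, smul_eq_mul, hfz, Finset.mul_sum, Finset.sum_mul]
  exact Finset.sum_congr rfl fun v _ => by ring

variable (D)

/-- Over `F` the ideal is generated, as a left ideal, by an idempotent, which is therefore a right
unit. Clearing denominators brings it down to `A`, and the involution supplies the left unit. -/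
theorem exists_isScaledUnit (F : Type*) [IsDomain R] [Field F] [Algebra R F] [IsFractionRing R F]
    (hss : IsSemisimpleRing (F ⊗[R] A)) {Γ : Set D.Λ} (hΓ : IsUpperSet Γ) :
    ∃ e q, D.IsScaledUnit Γ e q := by
  let I : Ideal (F ⊗[R] A) :=
    { (cellSpan R D.c Γ).baseChange F with
      smul_mem' := by
        intro z y hy
        change z * y ∈ (cellSpan R D.c Γ).baseChange F
        change y ∈ (cellSpan R D.c Γ).baseChange F at hy
        rw [Submodule.baseChange_eq_span] at hy
        induction hy using Submodule.span_induction with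
        | mem y hy =>
          obtain ⟨y, hy, rfl⟩ := hy
          induction z using TensorProduct.induction_on with
          | zero => simp
          | add z z' h h' => rw [add_mul]; exact Submodule.add_mem _ h h'
          | tmul k a =>
            rw [TensorProduct.mk_apply, Algebra.TensorProduct.tmul_mul_tmul]
            exact Submodule.tmul_mem_baseChange_of_mem _ (D.mul_mem_cellSpan' hΓ a hy)
        | zero => simp
        | add y y' _ _ h h' => rw [mul_add]; exact Submodule.add_mem _ h h'
        | smul k y _ h => rw [mul_smul_comm]; exact Submodule.smul_mem _ _ h }
  have hI : ∀ z, z ∈ I ↔ z ∈ (cellSpan R D.c Γ).baseChange F := fun z => Iff.rfl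
  obtain ⟨ε, hε, hIε⟩ := IsSemisimpleRing.ideal_eq_span_idempotent I
  have hmem : ε ∈ (cellSpan R D.c Γ).baseChange F := by
    rw [← hI, hIε]
    exact Ideal.mem_span_singleton_self ε
  obtain ⟨q, hq, e, he, hqe⟩ := Submodule.exists_smul_eq_one_tmul _ hmem
  have hfree : Module.Free R A := Module.Free.of_basis D.c
  have hinj := Algebra.TensorProduct.includeRight_injective (R := R) (A := F) (B := A)
    (IsFractionRing.injective R F)
  have hr : ∀ y ∈ cellSpan R D.c Γ, y * e = q • y := by
    intro y hy
    have h1 : (1 : F) ⊗ₜ[R] y ∈ I := (hI _).2 (Submodule.tmul_mem_baseChange_of_mem _ hy)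
    rw [hIε, Ideal.mem_span_singleton'] at h1
    obtain ⟨z, hz⟩ := h1
    have h2 : (1 : F) ⊗ₜ[R] y * ε = 1 ⊗ₜ y := by rw [← hz, mul_assoc, hε]
    apply hinj
    change (1 : F) ⊗ₜ[R] (y * e) = 1 ⊗ₜ[R] (q • y)
    rw [TensorProduct.tmul_smul, ← h2, ← algebraMap_smul F q, ← mul_smul_comm, hqe,
      Algebra.TensorProduct.tmul_mul_tmul, one_mul]
  have hl : ∀ y ∈ cellSpan R D.c Γ, D.inv e * y = q • y := by
    intro y hy
    have := congrArg D.inv (hr _ (D.inv_mem_cellSpan hΓ hy))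
    rwa [D.inv_mul, map_smul, D.inv_inv] at this
  -- A left and a right unit of the same ideal agree: `inv e * e` equals both `q • inv e` and `q •
  -- e`.
  have heq : D.inv e = e := by
    have h1 := hr _ (D.inv_mem_cellSpan hΓ he)
    rw [hl _ he] at h1
    have h3 : q • D.c.repr (e - D.inv e) = 0 := by
      rw [← map_smul, smul_sub, h1, sub_self, map_zero]
    have h4 := (smul_eq_zero.1 h3).resolve_left hq
    exact (sub_eq_zero.1 (D.c.repr.map_eq_zero_iff.1 h4)).symm
  exact ⟨e, q, he, hq, hr, heq ▸ hl⟩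

end

end CellDatum

theorem CellDatum.inv_one {R A : Type*} [CommRing R] [Ring A] [Algebra R A] (D : CellDatum R A) :
    D.inv 1 = 1 := by
  have h := D.inv_mul (D.inv 1) 1
  rw [mul_one, D.inv_inv, mul_one] at h
  exact h.symm

/-! ### Cell filtrations and leading terms. -/

namespace CellFiltration

variable {R A B : Type*} [CommRing R] [Ring A] [Algebra R A] [Ring B] [Algebra R B]
  {DA : CellDatum R A} {DB : CellDatum R B} {ι : A →ₐ[R] B} {ν : DB.Λ}
  (Φ : CellFiltration DA DB ι ν)

theorem monotone_N : Monotone Φ.N :=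
  Fin.monotone_iff_le_succ.2 Φ.N_mono

/-- The projection of a step of the filtration onto the cell module of its label. -/
noncomputable def proj (j : Fin Φ.n) : Φ.N j.succ →ₗ[R] DA.Cell (Φ.label j) :=
  (Φ.iso j : _ →ₗ[R] _) ∘ₗ
    Submodule.mkQ ((Φ.N j.castSucc).submoduleOf (Φ.N j.succ))

theorem proj_eq_zero_iff (j : Fin Φ.n) (x : Φ.N j.succ) :
    Φ.proj j x = 0 ↔ (x : DB.Cell ν) ∈ Φ.N j.castSucc := by
  change Φ.iso j (Submodule.Quotient.mk x) = 0 ↔ _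
  rw [LinearEquiv.map_eq_zero_iff, Submodule.Quotient.mk_eq_zero]
  rfl

theorem proj_act (j : Fin Φ.n) (x : Φ.N j.succ) (a : A) :
    Φ.proj j ⟨(DB.cellRep ν).act x (ι a), Φ.N_stable _ a _ x.2⟩ =
      (DA.cellRep (Φ.label j)).act (Φ.proj j x) a :=
  Φ.iso_mem j (Submodule.Quotient.mk x) a

/-- Inclusions can be tested on leading terms: subtracting an element of `X` with the same leading
term moves an element of `Z` one step down the filtration. -/
theorem le_of_forall_proj {X Z : Submodule R (DB.Cell ν)} (hXZ : X ≤ Z)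
    (H : ∀ (j : Fin Φ.n) (x : Φ.N j.succ), (x : DB.Cell ν) ∈ Z →
      Φ.proj j x ∈ (X.submoduleOf (Φ.N j.succ)).map (Φ.proj j)) : Z ≤ X := by
  have key : ∀ j : Fin (Φ.n + 1), ∀ x ∈ Φ.N j, x ∈ Z → x ∈ X := by
    intro j
    induction j using Fin.induction with
    | zero =>
      intro x hx _
      rw [Φ.N_zero, Submodule.mem_bot] at hx
      rw [hx]
      exact X.zero_mem
    | succ j ih =>
      intro x hx hxZ
      obtain ⟨y, hy, hyx⟩ := H j ⟨x, hx⟩ hxZ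
      have h0 : Φ.proj j (⟨x, hx⟩ - y) = 0 := by rw [map_sub, hyx, sub_self]
      rw [proj_eq_zero_iff] at h0
      have h1 := ih _ h0 (Z.sub_mem hxZ (hXZ hy))
      simpa using X.add_mem h1 hy
  intro x hx
  refine key (Fin.last Φ.n) x ?_ hx
  rw [Φ.N_last]
  exact Submodule.mem_top

end CellFiltration

namespace DiagramTower

variable {R F : Type*} [CommRing R] [IsDomain R] [Field F] [Algebra R F] [IsFractionRing R F]
  (T : DiagramTower R F)

/-! ### Generators -/

theorem δ_ne_zero (r : ℕ) (ν : (T.cell r).Λ) : T.δ r ν ≠ 0 := by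
  classical
  intro h
  obtain ⟨v⟩ := (T.cell r).nonempty ν
  obtain ⟨a, ha⟩ := T.δ_generates r ν (Pi.single v 1)
  rw [h, RightRep.zero_act] at ha
  simpa using congrFun ha v

/-- Some coordinate of the generator is nonzero, and the cell module is torsion-free. -/
theorem δ_tmul_eq_zero_iff {r : ℕ} {ν : (T.cell r).Λ} (x : (T.cell r).Cell ν) :
    T.δ r ν ⊗ₜ[R] x = 0 ↔ x = 0 := by
  refine ⟨fun h => ?_, fun h => by rw [h, TensorProduct.tmul_zero]⟩
  obtain ⟨v, hv⟩ := Function.ne_iff.1 (T.δ_ne_zero r ν)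
  have h1 := congrArg (TensorProduct.lid R _ ∘
    LinearMap.rTensor ((T.cell r).Cell ν) (LinearMap.proj v)) h
  simp only [Function.comp_apply, LinearMap.rTensor_tmul, TensorProduct.lid_tmul, map_zero,
    LinearMap.proj_apply] at h1
  exact (smul_eq_zero.1 h1).resolve_left hv

/-- The bimodule isomorphism sends the class of `m_ν a` to `δ ⊗ δ a`. This translates relations in
cell modules into relations in the algebra, where the compatibility of branching factors can be
applied. -/
theorem δ_act_eq_zero_iff {r : ℕ} {ν : (T.cell r).Λ} (a : T.A r) :
    ((T.cell r).cellRep ν).act (T.δ r ν) a = 0 ↔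
      (T.m r ν : T.A r) * a ∈ (T.cell r).gt ν := by
  have hmem : (T.m r ν : T.A r) * a ∈ (T.cell r).ge ν :=
    (T.cell r).mul_mem_cellSpan (isUpperSet_Ici ν) a (T.m r ν).2
  have h := T.α_bimodule r ν 1 a (T.m r ν) ⟨_, hmem⟩ (by rw [one_mul])
  rw [T.α_m, CellDatum.inv_one, TensorProduct.map_tmul] at h
  change _ = ((T.cell r).cellRep ν).act (T.δ r ν) 1 ⊗ₜ[R]
    ((T.cell r).cellRep ν).act (T.δ r ν) a at h
  rw [RightRep.act_one] at h
  rw [← T.δ_tmul_eq_zero_iff, ← h, LinearEquiv.map_eq_zero_iff, Submodule.Quotient.mk_eq_zero]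
  rfl

/-! ### Paths -/

variable {T}

theorem Path.ext_vertex {r : ℕ} {t t' : T.Path r} (h : ∀ k hk, t.vertex k hk = t'.vertex k hk) :
    t = t' := by
  cases t
  cases t'
  congr
  funext k hk
  exact h k hk

theorem Path.ext_trunc {r : ℕ} {t t' : T.Path (r + 1)}
    (h : t.trunc (Nat.le_succ r) = t'.trunc (Nat.le_succ r)) (h' : t.last = t'.last) : t = t' := by
  apply Path.ext_vertex
  intro k hk
  rcases Nat.le_succ_iff.1 hk with hk' | rfl
  · exact congrArg (fun p : T.Path r => p.vertex k hk') h
  · exact h'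

/-- The path of length `0` at a vertex. -/
def Path.nil (l : (T.cell 0).Λ) : T.Path 0 where
  vertex _ hk := (Nat.le_zero.1 hk).symm ▸ l
  edge _ h := absurd h (Nat.not_succ_le_zero _)

theorem Path.ext_last {t t' : T.Path 0} (h : t.last = t'.last) : t = t' := by
  apply Path.ext_vertex
  intro k hk
  obtain rfl := Nat.le_zero.1 hk
  exact h

/-- Extension of a path by an edge. -/
def Path.snoc {r : ℕ} (t : T.Path r) (ν : (T.cell (r + 1)).Λ) (hν : T.Edge t.last ν) :
    T.Path (r + 1) where
  vertex k hk := if h : k ≤ r then t.vertex k h else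
    (Nat.le_antisymm hk (not_le.1 h)).symm ▸ ν
  edge k h := by
    by_cases hk : k + 1 ≤ r
    · rw [dif_pos hk, dif_pos (Nat.le_of_succ_le hk)]
      exact t.edge k hk
    · obtain rfl : k = r := by omega
      rw [dif_pos (le_refl k), dif_neg hk]
      exact hν

theorem Path.snoc_last {r : ℕ} (t : T.Path r) (ν : (T.cell (r + 1)).Λ) (hν : T.Edge t.last ν) :
    (t.snoc ν hν).last = ν := by
  simp [Path.last, Path.snoc]

theorem Path.snoc_vertex {r : ℕ} (t : T.Path r) (ν : (T.cell (r + 1)).Λ) (hν : T.Edge t.last ν)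
    {k : ℕ} (hk : k ≤ r) : (t.snoc ν hν).vertex k (hk.trans (Nat.le_succ r)) = t.vertex k hk := by
  simp [Path.snoc, hk]

theorem Path.snoc_trunc {r : ℕ} (t : T.Path r) (ν : (T.cell (r + 1)).Λ) (hν : T.Edge t.last ν) :
    (t.snoc ν hν).trunc (Nat.le_succ r) = t :=
  Path.ext_vertex fun _ hk => t.snoc_vertex ν hν hk

instance Path.finite (r : ℕ) : Finite (T.Path r) := by
  have : Function.Injective (fun (t : T.Path r) (k : Fin (r + 1)) =>
      t.vertex k (Nat.lt_succ_iff.1 k.2)) := by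
    intro t t' h
    exact Path.ext_vertex fun k hk => congrFun h ⟨k, Nat.lt_succ_iff.2 hk⟩
  exact Finite.of_injective _ this

variable (T)

theorem exists_path_last (r : ℕ) (l : (T.cell r).Λ) : ∃ t : T.Path r, t.last = l := by
  induction r with
  | zero => exact ⟨Path.nil l, rfl⟩
  | succ r ih =>
    -- An empty filtration would make the cell module zero.
    have hn : 0 < (T.filt r l).n := by
      by_contra h
      have h0 : Fin.last (T.filt r l).n = 0 := Fin.ext (by simp; omega)
      have h1 := (T.filt r l).N_last
      rw [h0, (T.filt r l).N_zero] at h1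
      exact T.δ_ne_zero _ l ((Submodule.mem_bot R).1 (h1 ▸ Submodule.mem_top))
    obtain ⟨t, ht⟩ := ih ((T.filt r l).label ⟨0, hn⟩)
    exact ⟨t.snoc l ⟨_, ht.symm⟩, t.snoc_last _ _⟩

theorem exists_maximal_path (r : ℕ) (l : (T.cell r).Λ) :
    ∃ t : T.Path r, t.last = l ∧ t.IsMaximal := by
  let _ : PartialOrder (T.Path r) :=
    { le := fun t t' => t'.Dominates t
      le_refl := fun t k h => le_refl _
      le_trans := fun t₁ t₂ t₃ h₁ h₂ k h => (h₁ k h).trans (h₂ k h)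
      le_antisymm := fun t t' h h' =>
        Path.ext_vertex fun k hk => le_antisymm (h k hk) (h' k hk) }
  obtain ⟨t, ht⟩ := (Set.toFinite {t : T.Path r | t.last = l}).exists_maximal
    (T.exists_path_last r l)
  refine ⟨t, ht.1, fun t' hl hd => ?_⟩
  exact le_antisymm (ht.2 (hl.trans ht.1) hd) hd

/-! ### The Murphy basis -/

theorem act_δ_d {r : ℕ} (ν : (T.cell (r + 1)).Λ) (j : Fin (T.filt r ν).n) (a : T.A r) :
    ∃ h : ((T.cell (r + 1)).cellRep ν).act (T.δ (r + 1) ν)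
        (T.d r ((T.filt r ν).label j) ν * T.incl (Nat.le_succ r) a) ∈ (T.filt r ν).N j.succ,
      (T.filt r ν).proj j ⟨_, h⟩ =
        ((T.cell r).cellRep ((T.filt r ν).label j)).act (T.δ r ((T.filt r ν).label j)) a := by
  obtain ⟨h, hiso⟩ := T.d_spec r ν j
  have h1 := (T.filt r ν).proj_act j ⟨_, h⟩ a
  rw [show (T.filt r ν).proj j ⟨_, h⟩ = T.δ r ((T.filt r ν).label j) from hiso] at h1
  simp only [← RightRep.act_mul] at h1
  exact ⟨_, h1⟩

/-- The leading term of a Murphy element is the Murphy element of the truncated path; this drives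
the inductions along the filtration. -/
theorem murphy_proj {r : ℕ} {ν : (T.cell (r + 1)).Λ} (j : Fin (T.filt r ν).n)
    (t : T.Path (r + 1)) (ht : t.last = ν)
    (hj : t.vertex r (Nat.le_succ r) = (T.filt r ν).label j) :
    ∃ h : T.murphy ν t ∈ (T.filt r ν).N j.succ, (T.filt r ν).proj j ⟨_, h⟩ =
      T.murphy ((T.filt r ν).label j) (t.trunc (Nat.le_succ r)) := by
  have h := T.act_δ_d ν j (t.trunc (Nat.le_succ r)).d
  have hd : t.d = T.d r ((T.filt r ν).label j) ν *
      T.incl (Nat.le_succ r) (t.trunc (Nat.le_succ r)).d := by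
    rw [Path.d, ht, hj]
  simpa only [murphy, hd] using h

/-- The span of the Murphy basis elements of paths that are in `Γ` at level `s`. -/
noncomputable def levelSpan {s r : ℕ} (h : s ≤ r) (Γ : Set (T.cell s).Λ) (ν : (T.cell r).Λ) :
    Submodule R ((T.cell r).Cell ν) :=
  Submodule.span R {y | ∃ t : T.Path r, t.last = ν ∧ t.vertex s h ∈ Γ ∧ y = T.murphy ν t}

theorem levelSpan_label_le {s r : ℕ} (h : s ≤ r) (Γ : Set (T.cell s).Λ)
    (ν : (T.cell (r + 1)).Λ) (j : Fin (T.filt r ν).n) :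
    T.levelSpan h Γ ((T.filt r ν).label j) ≤
      ((T.levelSpan (h.trans (Nat.le_succ r)) Γ ν).submoduleOf
        ((T.filt r ν).N j.succ)).map ((T.filt r ν).proj j) := by
  apply Submodule.span_le.2
  rintro _ ⟨t, ht, hΓ, rfl⟩
  have he : T.Edge t.last ν := ⟨j, ht.symm⟩
  obtain ⟨hm, hp⟩ := T.murphy_proj j (t.snoc ν he) (t.snoc_last ν he)
    ((t.snoc_vertex ν he (le_refl r)).trans ht)
  refine ⟨⟨_, hm⟩, Submodule.subset_span ⟨_, t.snoc_last ν he, ?_, rfl⟩, ?_⟩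
  · rwa [t.snoc_vertex ν he h]
  · rw [hp, t.snoc_trunc]

/-- With no restriction on the paths, this says that the Murphy elements span `Δ_r(ν)`. Leading
terms reduce it to level `0`, where `A_0 = R` makes the cell module the line through its generator.
-/
theorem levelSpan_univ (r : ℕ) (ν : (T.cell r).Λ) :
    T.levelSpan (Nat.zero_le r) Set.univ ν = ⊤ := by
  induction r with
  | zero =>
    rw [eq_top_iff]
    intro x _
    obtain ⟨a, rfl⟩ := T.δ_generates 0 ν x
    obtain ⟨c, rfl⟩ := T.zero_bijective.2 a
    rw [Algebra.algebraMap_eq_smul_one, RightRep.act_smul]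
    exact Submodule.smul_mem _ _ (Submodule.subset_span ⟨Path.nil ν, rfl, trivial, rfl⟩)
  | succ r ih =>
    rw [eq_top_iff]
    apply (T.filt r ν).le_of_forall_proj le_top
    intro j x _
    apply T.levelSpan_label_le
    rw [ih]
    exact Submodule.mem_top

theorem linearIndepOn_murphy (r : ℕ) (ν : (T.cell r).Λ) :
    LinearIndepOn R (T.murphy ν) {t | t.last = ν} := by
  induction r with
  | zero =>
    have h0 : T.murphy ν (Path.nil ν) ≠ 0 := by
      change ((T.cell 0).cellRep ν).act (T.δ 0 ν) 1 ≠ 0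
      rw [RightRep.act_one]
      exact T.δ_ne_zero 0 ν
    refine (LinearIndepOn.singleton h0).mono ?_
    intro t ht
    exact Path.ext_last ht
  | succ r ih =>
    let Φ := T.filt r ν
    -- The paths to `ν` whose Murphy elements already lie in `Φ.N j`.
    let S : Fin (Φ.n + 1) → Set (T.Path (r + 1)) := fun j =>
      {t | t.last = ν ∧ ∃ i : Fin Φ.n, i.castSucc < j ∧
        t.vertex r (Nat.le_succ r) = Φ.label i}
    have key : ∀ j, LinearIndepOn R (T.murphy ν) (S j) := by
      intro j
      induction j using Fin.induction with
      | zero =>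
        have : S 0 = ∅ := by
          ext t
          simp [S]
        rw [this]
        exact linearIndepOn_empty R _
      | succ j ihj =>
        let S' : Set (T.Path (r + 1)) :=
          {t | t.last = ν ∧ t.vertex r (Nat.le_succ r) = Φ.label j}
        have hS : S j.succ ⊆ S j.castSucc ∪ S' := by
          rintro t ⟨ht, i, hi, hv⟩
          rcases lt_or_eq_of_le (Fin.le_castSucc_iff.2 hi) with hlt | heq
          · exact Or.inl ⟨ht, i, hlt, hv⟩
          · exact Or.inr ⟨ht, by rw [hv, Fin.castSucc_injective _ heq]⟩
        refine LinearIndepOn.mono (ihj.union_of_quotient ?_) hS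
        have hle : Submodule.span R (T.murphy ν '' S j.castSucc) ≤ Φ.N j.castSucc := by
          apply Submodule.span_le.2
          rintro _ ⟨t, ⟨ht, i, hi, hv⟩, rfl⟩
          obtain ⟨hm, -⟩ := T.murphy_proj i t ht hv
          refine Φ.monotone_N ?_ hm
          exact Fin.succ_le_castSucc_iff.2 (Fin.castSucc_lt_castSucc_iff.1 hi)
        -- The leading terms at step `j` are Murphy elements of distinct truncated paths,
        -- independent by induction, so no nontrivial combination drops into the previous step.
        have hker : ∀ l : S' →₀ R,
            Finsupp.linearCombination R (fun t : S' => T.murphy ν t.1) l ∈ Φ.N j.castSucc →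
            l = 0 := by
          intro l hl
          have hmN : ∀ t : S', T.murphy ν t.1 ∈ Φ.N j.succ := fun t =>
            (T.murphy_proj j t.1 t.2.1 t.2.2).1
          let f : S' → Φ.N j.succ := fun t => ⟨_, hmN t⟩
          have hf : ((Finsupp.linearCombination R f l : Φ.N j.succ) : (T.cell (r + 1)).Cell ν) =
              Finsupp.linearCombination R (fun t : S' => T.murphy ν t.1) l := by
            rw [← Submodule.subtype_apply, Finsupp.apply_linearCombination]
            rfl
          rw [← hf, ← Φ.proj_eq_zero_iff, Finsupp.apply_linearCombination] at hl
          have hli : LinearIndependent R (Φ.proj j ∘ f) := by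
            have h1 : Φ.proj j ∘ f = (fun t : {t : T.Path r | t.last = Φ.label j} =>
                T.murphy (Φ.label j) t.1) ∘
                fun t : S' => ⟨t.1.trunc (Nat.le_succ r), t.2.2⟩ := by
              funext t
              exact (T.murphy_proj j t.1 t.2.1 t.2.2).2
            rw [h1]
            refine (ih (Φ.label j)).comp _ ?_
            intro t t' htt
            apply Subtype.ext
            exact Path.ext_trunc (congrArg Subtype.val htt) (t.2.1.trans t'.2.1.symm)
          exact linearIndependent_iff.1 hli l hl
        refine linearIndependent_iff.2 fun l hl => hker l (hle ?_)
        have h2 : Finsupp.linearCombination R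
            (fun t : S' => ((Submodule.span R (T.murphy ν '' S j.castSucc)).mkQ ∘
              T.murphy ν) t.1) l = (Submodule.span R (T.murphy ν '' S j.castSucc)).mkQ
            (Finsupp.linearCombination R (fun t : S' => T.murphy ν t.1) l) := by
          rw [Finsupp.apply_linearCombination]
          rfl
        rw [h2, Submodule.mkQ_apply, Submodule.Quotient.mk_eq_zero] at hl
        exact hl
    refine (key (Fin.last _)).mono ?_
    intro t ht
    obtain ⟨j, hj⟩ := t.edge r (le_refl _)
    have ht' : t.vertex (r + 1) (le_refl _) = ν := ht
    subst ht'
    exact ⟨rfl, j, Fin.castSucc_lt_last j, hj.symm⟩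

theorem exists_murphy_coord {r : ℕ} (t₀ : T.Path r) :
    ∃ f : (T.cell r).Cell t₀.last →ₗ[R] R, f (T.murphy t₀.last t₀) = 1 ∧
      ∀ t : T.Path r, t.last = t₀.last → t ≠ t₀ → f (T.murphy t₀.last t) = 0 := by
  classical
  let β := Module.Basis.mk (T.linearIndepOn_murphy r t₀.last) (by
    rw [← T.levelSpan_univ]
    apply Submodule.span_mono
    rintro _ ⟨t, ht, -, rfl⟩
    exact ⟨⟨t, ht⟩, rfl⟩)
  have hβ : ∀ (t : T.Path r) (ht : t.last = t₀.last), β ⟨t, ht⟩ = T.murphy t₀.last t :=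
    fun t ht => Module.Basis.mk_apply _ _ _
  refine ⟨β.coord ⟨t₀, rfl⟩, ?_, fun t ht hne => ?_⟩
  · rw [← hβ t₀ rfl, Module.Basis.coord_apply, Module.Basis.repr_self, Finsupp.single_eq_same]
  · rw [← hβ t ht, Module.Basis.coord_apply, Module.Basis.repr_self, Finsupp.single_eq_of_ne]
    intro h
    exact hne (congrArg Subtype.val h).symm

end DiagramTower

namespace DiagramTower

variable {R F : Type*} [CommRing R] [IsDomain R] [Field F] [Algebra R F] [IsFractionRing R F]
  (T : DiagramTower R F)

theorem exists_isScaledUnit {s : ℕ} {Γ : Set (T.cell s).Λ} (hΓ : IsUpperSet Γ) :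
    ∃ e q, (T.cell s).IsScaledUnit Γ e q :=
  (T.cell s).exists_isScaledUnit F (T.semisimple s).isSemisimpleRing hΓ

/-! ### Level ideals -/

/-- `D` is the product of the branching factors above level `s`, and `e` the corresponding product
of `u`-factors: the compatibility relation moves `m` down the path one edge at a time. -/
theorem exists_factor {s r : ℕ} (h : s ≤ r) (t : T.Path r) : ∃ D e : T.A r,
    t.d = D * T.incl h (t.trunc h).d ∧
      (T.m r t.last : T.A r) * D = (T.cell r).inv e * T.incl h (T.m s (t.vertex s h)) := by
  induction r, h using Nat.le_induction with
  | base =>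
    refine ⟨1, 1, ?_, ?_⟩
    · rw [T.incl_refl, one_mul]
      rfl
    · rw [T.incl_refl, CellDatum.inv_one, one_mul, mul_one]
      rfl
  | succ r h ih =>
    obtain ⟨D, e, hD, he⟩ := ih (t.trunc (Nat.le_succ r))
    obtain ⟨j, hj⟩ := t.edge r (le_refl _)
    obtain ⟨e', he'⟩ := T.compatible r t.last j
    have hj' : (T.filt r t.last).label j = (t.trunc (Nat.le_succ r)).last := hj
    rw [hj'] at he'
    refine ⟨T.d r (t.trunc (Nat.le_succ r)).last t.last * T.incl (Nat.le_succ r) D,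
      T.incl (Nat.le_succ r) e * e', ?_, ?_⟩
    · rw [mul_assoc, ← T.incl_trans h (Nat.le_succ r), ← map_mul]
      have := congrArg (fun z => T.d r (t.trunc (Nat.le_succ r)).last t.last *
        T.incl (Nat.le_succ r) z) hD
      exact this
    · rw [← mul_assoc, he', mul_assoc, ← map_mul, he, map_mul, T.incl_trans, T.incl_inv,
        ← mul_assoc, ← (T.cell (r + 1)).inv_mul]
      rfl

/-- The submodule of `Δ_r(ν)` on which `e ∈ A_s` acts as the scalar `q`. -/
noncomputable def scaledFixed {s r : ℕ} (h : s ≤ r) (ν : (T.cell r).Λ) (e : T.A s) (q : R) :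
    Submodule R ((T.cell r).Cell ν) :=
  LinearMap.ker (((T.cell r).cellRep ν (T.incl h e)).unop - q • LinearMap.id)

variable {T}

theorem mem_scaledFixed {s r : ℕ} {h : s ≤ r} {ν : (T.cell r).Λ} {e : T.A s} {q : R}
    {x : (T.cell r).Cell ν} :
    x ∈ T.scaledFixed h ν e q ↔ ((T.cell r).cellRep ν).act x (T.incl h e) = q • x := by
  rw [scaledFixed, LinearMap.mem_ker, LinearMap.sub_apply, sub_eq_zero]
  rfl

theorem mem_scaledFixed_of_smul_mem {s r : ℕ} {h : s ≤ r} {ν : (T.cell r).Λ} {e : T.A s} {q c : R}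
    (hc : c ≠ 0) {x : (T.cell r).Cell ν} (hx : c • x ∈ T.scaledFixed h ν e q) :
    x ∈ T.scaledFixed h ν e q := by
  rw [mem_scaledFixed, RightRep.smul_act, smul_comm q c] at hx
  rw [mem_scaledFixed]
  exact smul_right_injective _ hc hx

theorem scaledFixed_stable {s r : ℕ} (h : s ≤ r) (ν : (T.cell r).Λ) (e : T.A s) (q : R) :
    (T.commutantRep h ν).Stable (T.scaledFixed h ν e q) := by
  rintro ⟨a, ha⟩ x hx
  change ((T.cell r).cellRep ν).act x a ∈ _
  rw [mem_scaledFixed] at hx ⊢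
  have hc : T.incl h e * a = a * T.incl h e :=
    Subalgebra.mem_centralizer_iff R |>.1 ha _ ⟨e, rfl⟩
  rw [← RightRep.act_mul, ← hc, RightRep.act_mul, hx, RightRep.smul_act]

/-- If `δ(ν) D a` arises from an element `m_l a` in the cell ideal of `Γ`, it is fixed by the unit
of that ideal. -/
theorem act_mem_scaledFixed {s r : ℕ} {h : s ≤ r} {ν : (T.cell r).Λ} {l : (T.cell s).Λ}
    {D e' : T.A r}
    (hD : (T.m r ν : T.A r) * D = (T.cell r).inv e' * T.incl h (T.m s l))
    {Γ : Set (T.cell s).Λ} {e : T.A s} {q : R} (he : (T.cell s).IsScaledUnit Γ e q)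
    {a : T.A s} (ha : (T.m s l : T.A s) * a ∈ cellSpan R (T.cell s).c Γ) :
    ((T.cell r).cellRep ν).act (T.δ r ν) (D * T.incl h a) ∈ T.scaledFixed h ν e q := by
  rw [mem_scaledFixed, ← RightRep.act_mul, ← sub_eq_zero, ← RightRep.act_smul,
    ← RightRep.act_sub, T.δ_act_eq_zero_iff]
  -- After `m_ν D` is replaced by `e'^* m_l`, the element `e` multiplies `m_l a` inside its own
  -- ideal, so the product vanishes in `A_r` and not only modulo higher cells.
  have h0 : (T.m r ν : T.A r) * (D * T.incl h a * T.incl h e - q • (D * T.incl h a)) = 0 := by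
    have h1 := he.mul_right _ ha
    rw [mul_sub, mul_smul_comm, ← mul_assoc, ← mul_assoc, hD, mul_assoc, mul_assoc, ← map_mul,
      ← map_mul, ← mul_assoc, h1, mul_assoc, ← map_mul, map_smul, mul_smul_comm, sub_self]
  rw [h0]
  exact Submodule.zero_mem _

theorem murphy_mem_scaledFixed {s r : ℕ} (h : s ≤ r) {Γ : Set (T.cell s).Λ} (hΓ : IsUpperSet Γ)
    {e : T.A s} {q : R} (he : (T.cell s).IsScaledUnit Γ e q) (t : T.Path r)
    (ht : t.vertex s h ∈ Γ) : T.murphy t.last t ∈ T.scaledFixed h t.last e q := by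
  obtain ⟨D, e', hd, hD⟩ := T.exists_factor h t
  rw [murphy, hd]
  refine act_mem_scaledFixed hD he ((T.cell s).mul_mem_cellSpan hΓ _ ?_)
  refine (T.cell s).cellSpan_mono ?_ (T.m s (t.vertex s h)).2
  exact fun _ hm => hΓ hm ht

/-- The right side is visibly stable under `A_r ∩ A_s'` and pure, while the left side has a path
description. At `r = s` the element `e` acts on `Δ_s(ν)` as `q` or as `0`, according to whether `ν ∈
Γ`; for larger `r` leading terms inherit the eigenvalue condition. -/
theorem levelSpan_eq_scaledFixed {s r : ℕ} (h : s ≤ r) {Γ : Set (T.cell s).Λ} (hΓ : IsUpperSet Γ)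
    {e : T.A s} {q : R} (he : (T.cell s).IsScaledUnit Γ e q) (ν : (T.cell r).Λ) :
    T.levelSpan h Γ ν = T.scaledFixed h ν e q := by
  have hle : ∀ {r : ℕ} (h : s ≤ r) (ν : (T.cell r).Λ),
      T.levelSpan h Γ ν ≤ T.scaledFixed h ν e q := by
    intro r h ν
    apply Submodule.span_le.2
    rintro _ ⟨t, rfl, ht, rfl⟩
    exact murphy_mem_scaledFixed h hΓ he t ht
  refine le_antisymm (hle h ν) ?_
  induction r, h using Nat.le_induction with
  | base =>
    by_cases hν : ν ∈ Γ
    · rw [show T.levelSpan (le_refl s) Γ ν = ⊤ from ?_]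
      · exact le_top
      · rw [eq_top_iff, ← T.levelSpan_univ]
        apply Submodule.span_mono
        rintro _ ⟨t, rfl, -, rfl⟩
        exact ⟨t, rfl, hν, rfl⟩
    · intro x hx
      rw [mem_scaledFixed, T.incl_refl, (T.cell s).act_eq_zero_of_mem hΓ hν he.mem] at hx
      rw [(smul_eq_zero.1 hx.symm).resolve_left he.ne_zero]
      exact Submodule.zero_mem _
  | succ r h ih =>
    refine (T.filt r ν).le_of_forall_proj (hle _ ν) fun j x hx => ?_
    refine T.levelSpan_label_le h Γ ν j (ih _ ?_)
    rw [mem_scaledFixed, ← T.incl_trans h (Nat.le_succ r)] at hx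
    rw [mem_scaledFixed, ← CellFiltration.proj_act, ← map_smul]
    exact congrArg _ (Subtype.ext hx)

/-- Relations between Murphy basis elements in a cell module of `A_s` lift to the Murphy basis
elements of `A_r`, modulo higher terms. -/
theorem murphy_act_mem_aboveSpan {s r : ℕ} (h : s ≤ r) (t : T.Path r) (a : T.A s)
    (h0 : ((T.cell s).cellRep (t.vertex s h)).act
      (T.murphy (t.vertex s h) (t.trunc h)) a = 0) :
    ((T.cell r).cellRep t.last).act (T.murphy t.last t) (T.incl h a) ∈
      T.aboveSpan h (t.vertex s h) t.last := by
  have hu := isUpperSet_Ioi (t.vertex s h)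
  obtain ⟨e, q, he⟩ := T.exists_isScaledUnit hu
  change _ ∈ T.levelSpan h (Set.Ioi (t.vertex s h)) t.last
  rw [levelSpan_eq_scaledFixed h hu he]
  obtain ⟨D, e', hd, hD⟩ := T.exists_factor h t
  rw [murphy, hd, ← RightRep.act_mul, mul_assoc, ← map_mul]
  refine act_mem_scaledFixed hD he ?_
  -- The relation in the cell module of `A_s` says that `m_l d a` lies in `A_s^{▷ l}`, where `d`
  -- belongs to the truncated path.
  rw [murphy, ← RightRep.act_mul, T.δ_act_eq_zero_iff] at h0
  exact h0

/-! ### The matrix units attached to a path -/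

/-- `b` is, up to the scalar `q`, the row at `m_{t₀}` of a system of matrix units for the block
of `A_s` that belongs to the endpoint of `t₀`. -/
structure IsMatrixRow {s : ℕ} (t₀ : T.Path s) (b : (T.cell s).Cell t₀.last →ₗ[R] T.A s)
    (q : R) : Prop where
  ne_zero : q ≠ 0
  mem_ge : ∀ x, b x ∈ (T.cell s).ge t₀.last
  act_self : ∀ x, ((T.cell s).cellRep t₀.last).act (T.murphy t₀.last t₀) (b x) = q • x
  act_of_ne : ∀ t : T.Path s, t.last = t₀.last → t ≠ t₀ → ∀ x,
    ((T.cell s).cellRep t₀.last).act (T.murphy t₀.last t) (b x) = 0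
  mul_right : ∀ x a, b x * a = b (((T.cell s).cellRep t₀.last).act x a)
  gt_mul : ∀ y ∈ (T.cell s).gt t₀.last, ∀ x, y * b x = 0

theorem exists_isMatrixRow {s : ℕ} (t₀ : T.Path s) : ∃ b q, IsMatrixRow t₀ b q := by
  have hu := isUpperSet_Ioi t₀.last
  have hu' := isUpperSet_Ici t₀.last
  have hn : t₀.last ∉ Set.Ioi t₀.last := Set.self_notMem_Ioi
  obtain ⟨e₁, q₁, he₁⟩ := T.exists_isScaledUnit hu'
  obtain ⟨e₂, q₂, he₂⟩ := T.exists_isScaledUnit hu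
  obtain ⟨f, hf, hf0⟩ := T.exists_murphy_coord t₀
  obtain ⟨b, hb, hact⟩ := he₁.exists_rankOne f
  -- Up to the scalar `q₂`, this is the central idempotent complementary to `A_s^{▷ l}`: it kills
  -- that ideal and acts as `q₂` on the cell module. It turns congruences modulo `A_s^{▷ l}` into
  -- equalities.
  let p : T.A s := q₂ • 1 - e₂
  have hp0 : ∀ y ∈ (T.cell s).gt t₀.last, y * p = 0 := by
    intro y hy
    rw [mul_sub, he₂.mul_right y hy, mul_smul_comm, mul_one, sub_self]
  have hpc : ∀ a, a * p = p * a := by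
    intro a
    rw [mul_sub, sub_mul, he₂.comm hu, mul_smul_comm, smul_mul_assoc, mul_one, one_mul]
  have hpact : ∀ x, ((T.cell s).cellRep t₀.last).act x p = q₂ • x := by
    intro x
    rw [RightRep.act_sub, RightRep.act_smul, RightRep.act_one,
      (T.cell s).act_eq_zero_of_mem hu hn he₂.mem, sub_zero]
  have hact' : ∀ z x, ((T.cell s).cellRep t₀.last).act z (b x * p) =
      (q₁ * q₂ * f z) • x := by
    intro z x
    rw [RightRep.act_mul, hact, RightRep.smul_act, hpact, smul_smul]
    congr 1
    ring
  refine ⟨LinearMap.mulRight R p ∘ₗ b, q₁ * q₂, mul_ne_zero he₁.ne_zero he₂.ne_zero, ?_, ?_, ?_,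
    ?_, ?_⟩
  · exact fun x => (T.cell s).mul_mem_cellSpan hu' p (hb x)
  · intro x
    exact (hact' _ _).trans (by rw [hf, mul_one])
  · intro t ht hne x
    exact (hact' _ _).trans (by rw [hf0 t ht hne, mul_zero, zero_smul])
  · intro x a
    change b x * p * a = b _ * p
    rw [mul_assoc, ← hpc, ← mul_assoc, ← sub_eq_zero, ← sub_mul]
    apply hp0
    -- `b x * a` and `b (x · a)` act alike on the cell module, hence differ by an element of `A_s^{▷
    -- l}`.
    refine he₁.mem_gt_of_act_eq_zero
      (Submodule.sub_mem _ ((T.cell s).mul_mem_cellSpan hu' a (hb x)) (hb _)) fun z => ?_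
    rw [RightRep.act_sub, RightRep.act_mul, hact, hact, RightRep.smul_act, sub_self]
  · intro y hy x
    change y * (b x * p) = 0
    rw [hpc, ← mul_assoc, hp0 y hy, zero_mul]

/-! ### Skew cell modules -/

namespace IsMatrixRow

variable {s r : ℕ} {t₀ : T.Path s} {b : (T.cell s).Cell t₀.last →ₗ[R] T.A s} {q : R}
-- On this span the scaled unit `e` of `A_s^{▷ l}` acts as a nonzero scalar, while `e * b x = 0`.
theorem aboveSpan_act (hb : IsMatrixRow t₀ b q) (h : s ≤ r) (ν : (T.cell r).Λ)
    (x : (T.cell s).Cell t₀.last) {y : (T.cell r).Cell ν}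
    (hy : y ∈ T.aboveSpan h t₀.last ν) :
    ((T.cell r).cellRep ν).act y (T.incl h (b x)) = 0 := by
  have hu := isUpperSet_Ioi t₀.last
  obtain ⟨e, c, he⟩ := T.exists_isScaledUnit hu
  change y ∈ T.levelSpan h (Set.Ioi t₀.last) ν at hy
  rw [levelSpan_eq_scaledFixed h hu he, mem_scaledFixed] at hy
  have h1 := congrArg (fun z => ((T.cell r).cellRep ν).act z (T.incl h (b x))) hy
  simp only [← RightRep.act_mul, ← map_mul, RightRep.smul_act] at h1
  rw [hb.gt_mul e he.mem, map_zero, RightRep.act_zero] at h1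
  exact (smul_eq_zero.1 h1.symm).resolve_left he.ne_zero

theorem act_mem_levelSpan (hb : IsMatrixRow t₀ b q) (h : s ≤ r) (ν : (T.cell r).Λ)
    (x : (T.cell s).Cell t₀.last) (y : (T.cell r).Cell ν) :
    ((T.cell r).cellRep ν).act y (T.incl h (b x)) ∈ T.levelSpan h (Set.Ici t₀.last) ν := by
  have hu := isUpperSet_Ici t₀.last
  obtain ⟨e, c, he⟩ := T.exists_isScaledUnit hu
  rw [levelSpan_eq_scaledFixed h hu he, mem_scaledFixed, ← RightRep.act_mul, ← map_mul,
    he.mul_right _ (hb.mem_ge x), map_smul, RightRep.act_smul]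

/-- Lifting relations from `Δ_s(l)` shows that, modulo higher terms, the diagonal matrix unit acts
as `q` on Murphy elements through `t₀` and as `0` on those through other paths to `l`. So its
`q`-eigenspace modulo higher terms is the span through `t₀`. -/
theorem through_sup_above_mem_iff (hb : IsMatrixRow t₀ b q) (h : s ≤ r) (ν : (T.cell r).Λ)
    (y : (T.cell r).Cell ν) :
    y ∈ T.throughSpan h t₀ ν ⊔ T.aboveSpan h t₀.last ν ↔
      y ∈ T.levelSpan h (Set.Ici t₀.last) ν ∧
        ((T.cell r).cellRep ν).act y (T.incl h (b (T.murphy t₀.last t₀))) - q • y ∈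
          T.aboveSpan h t₀.last ν := by
  let η : Module.End R ((T.cell r).Cell ν) :=
    ((T.cell r).cellRep ν (T.incl h (b (T.murphy t₀.last t₀)))).unop
  change _ ↔ _ ∧ η y - q • y ∈ _
  have habove : ∀ z ∈ T.aboveSpan h t₀.last ν, η z = 0 := fun z hz =>
    hb.aboveSpan_act h ν _ hz
  have hthrough : ∀ t : T.Path r, t.last = ν → t.trunc h = t₀ →
      η (T.murphy ν t) - q • T.murphy ν t ∈ T.aboveSpan h t₀.last ν := by
    rintro t rfl rfl
    have := murphy_act_mem_aboveSpan h t
      (b (T.murphy (t.trunc h).last (t.trunc h)) - q • 1) (by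
        rw [RightRep.act_sub, RightRep.act_smul, RightRep.act_one, sub_eq_zero]
        exact hb.act_self _)
    rwa [map_sub, map_smul, map_one, RightRep.act_sub, RightRep.act_smul, RightRep.act_one]
      at this
  have hother : ∀ t : T.Path r, t.last = ν → t.vertex s h = t₀.last → t.trunc h ≠ t₀ →
      η (T.murphy ν t) ∈ T.aboveSpan h t₀.last ν := by
    rintro t rfl hv hne
    have := murphy_act_mem_aboveSpan h t (b (T.murphy t₀.last t₀)) (by
      rw [hv]
      exact hb.act_of_ne (t.trunc h) hv hne _)
    rwa [hv] at this
  constructor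
  · intro hy
    constructor
    · refine (sup_le ?_ ?_ : _ ≤ T.levelSpan h (Set.Ici t₀.last) ν) hy
      · apply Submodule.span_mono
        rintro _ ⟨t, ht, rfl, rfl⟩
        exact ⟨t, ht, le_refl (t.vertex s h), rfl⟩
      · apply Submodule.span_mono
        rintro _ ⟨t, ht, hv, rfl⟩
        exact ⟨t, ht, le_of_lt hv, rfl⟩
    · revert y
      change _ ≤ (T.aboveSpan h t₀.last ν).comap (η - q • LinearMap.id)
      apply sup_le
      · apply Submodule.span_le.2
        rintro _ ⟨t, ht, ht', rfl⟩
        exact hthrough t ht ht'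
      · intro z hz
        change η z - q • z ∈ T.aboveSpan h t₀.last ν
        rw [habove z hz, zero_sub]
        exact Submodule.neg_mem _ (Submodule.smul_mem _ _ hz)
  · rintro ⟨hy, hyη⟩
    have key : ∃ z ∈ T.throughSpan h t₀ ν, η y - q • z ∈ T.aboveSpan h t₀.last ν := by
      clear hyη
      induction hy using Submodule.span_induction with
      | mem y hy =>
        obtain ⟨t, ht, hv, rfl⟩ := hy
        by_cases ht' : t.trunc h = t₀
        · exact ⟨_, Submodule.subset_span ⟨t, ht, ht', rfl⟩, hthrough t ht ht'⟩
        · refine ⟨0, Submodule.zero_mem _, ?_⟩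
          rw [smul_zero, sub_zero]
          rcases eq_or_lt_of_le (show t₀.last ≤ t.vertex s h from hv) with heq | hlt
          · exact hother t ht heq.symm ht'
          · rw [habove _ (Submodule.subset_span ⟨t, ht, hlt, rfl⟩)]
            exact Submodule.zero_mem _
      | zero => exact ⟨0, Submodule.zero_mem _, by simp⟩
      | add y y' _ _ ih ih' =>
        obtain ⟨z, hz, hzy⟩ := ih
        obtain ⟨z', hz', hzy'⟩ := ih'
        refine ⟨z + z', Submodule.add_mem _ hz hz', ?_⟩
        have := Submodule.add_mem _ hzy hzy'
        convert this using 1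
        rw [map_add, smul_add]
        abel
      | smul c y _ ih =>
        obtain ⟨z, hz, hzy⟩ := ih
        refine ⟨c • z, Submodule.smul_mem _ _ hz, ?_⟩
        have := Submodule.smul_mem _ c hzy
        rwa [smul_sub, ← map_smul, smul_comm c q] at this
    obtain ⟨z, hz, hzy⟩ := key
    have h1 : q • (y - z) ∈ T.aboveSpan h t₀.last ν := by
      have := Submodule.sub_mem _ hzy hyη
      convert this using 1
      rw [smul_sub]
      abel
    -- Cancelling `q` is allowed because `aboveSpan` is an eigenspace of an element of `A_s` in a
    -- torsion-free module.
    have h2 : y - z ∈ T.aboveSpan h t₀.last ν := by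
      have hu := isUpperSet_Ioi t₀.last
      obtain ⟨e, c, he⟩ := T.exists_isScaledUnit hu
      change _ ∈ T.levelSpan h (Set.Ioi t₀.last) ν at h1 ⊢
      rw [levelSpan_eq_scaledFixed h hu he] at h1 ⊢
      exact mem_scaledFixed_of_smul_mem hb.ne_zero h1
    have h3 := Submodule.add_mem_sup hz h2
    rwa [add_sub_cancel] at h3

end IsMatrixRow

theorem levelSpan_stable {s r : ℕ} (h : s ≤ r) {Γ : Set (T.cell s).Λ} (hΓ : IsUpperSet Γ)
    (ν : (T.cell r).Λ) : (T.commutantRep h ν).Stable (T.levelSpan h Γ ν) := by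
  obtain ⟨e, q, he⟩ := T.exists_isScaledUnit hΓ
  rw [levelSpan_eq_scaledFixed h hΓ he]
  exact scaledFixed_stable h ν e q

theorem aboveSpan_stable {s r : ℕ} (h : s ≤ r) (l : (T.cell s).Λ) (ν : (T.cell r).Λ) :
    (T.commutantRep h ν).Stable (T.aboveSpan h l ν) :=
  levelSpan_stable h (isUpperSet_Ioi l) ν

theorem commutantRep_act_comm {s r : ℕ} (h : s ≤ r) (ν : (T.cell r).Λ) (c : T.commutant h)
    (a : T.A s) (x : (T.cell r).Cell ν) :
    ((T.cell r).cellRep ν).act ((T.commutantRep h ν).act x c) (T.incl h a) =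
      (T.commutantRep h ν).act (((T.cell r).cellRep ν).act x (T.incl h a)) c := by
  change ((T.cell r).cellRep ν).act (((T.cell r).cellRep ν).act x c) _ =
    ((T.cell r).cellRep ν).act _ c
  rw [← RightRep.act_mul, ← RightRep.act_mul,
    Subalgebra.mem_centralizer_iff R |>.1 c.2 _ ⟨a, rfl⟩]

/-- Both conditions of `through_sup_above_mem_iff` are preserved by elements that commute with
`A_s`. -/
theorem through_sup_above_stable {s r : ℕ} (h : s ≤ r) (t₀ : T.Path s) (ν : (T.cell r).Λ) :
    (T.commutantRep h ν).Stable (T.throughSpan h t₀ ν ⊔ T.aboveSpan h t₀.last ν) := by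
  obtain ⟨b, q, hb⟩ := exists_isMatrixRow t₀
  intro c x hx
  rw [hb.through_sup_above_mem_iff] at hx ⊢
  refine ⟨levelSpan_stable h (isUpperSet_Ici _) ν c x hx.1, ?_⟩
  rw [commutantRep_act_comm, ← RightRep.smul_act, ← RightRep.sub_act]
  exact aboveSpan_stable h _ ν c _ hx.2

/-- Right multiplication by a diagonal matrix unit embeds the skew cell module in `Δ_r(ν)`. -/
noncomputable def skewEmbedding {s r : ℕ} {t₀ : T.Path s}
    {b : (T.cell s).Cell t₀.last →ₗ[R] T.A s} {q : R} (hb : IsMatrixRow t₀ b q) (h : s ≤ r)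
    (ν : (T.cell r).Λ) : T.Skew h t₀ ν →ₗ[R] (T.cell r).Cell ν :=
  Submodule.liftQ _ (((T.cell r).cellRep ν (T.incl h (b (T.murphy t₀.last t₀)))).unop ∘ₗ
    Submodule.subtype _) fun _ hx => hb.aboveSpan_act h ν _ hx

theorem skewEmbedding_mk {s r : ℕ} {t₀ : T.Path s}
    {b : (T.cell s).Cell t₀.last →ₗ[R] T.A s} {q : R} (hb : IsMatrixRow t₀ b q) (h : s ≤ r)
    (ν : (T.cell r).Λ) (x : ↥(T.throughSpan h t₀ ν ⊔ T.aboveSpan h t₀.last ν)) :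
    skewEmbedding hb h ν (Submodule.Quotient.mk x) =
      ((T.cell r).cellRep ν).act x (T.incl h (b (T.murphy t₀.last t₀))) :=
  rfl

/-- If the diagonal unit kills `x`, then `q • x` lies in `aboveSpan`, hence so does `x`. -/
theorem skewEmbedding_injective {s r : ℕ} {t₀ : T.Path s}
    {b : (T.cell s).Cell t₀.last →ₗ[R] T.A s} {q : R} (hb : IsMatrixRow t₀ b q) (h : s ≤ r)
    (ν : (T.cell r).Λ) : Function.Injective (skewEmbedding hb h ν) := by
  rw [injective_iff_map_eq_zero]
  intro y hy
  induction y using Submodule.Quotient.induction_on with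
  | H x =>
    rw [skewEmbedding_mk] at hy
    have hx := ((hb.through_sup_above_mem_iff h ν x).1 x.2).2
    rw [hy, zero_sub, Submodule.neg_mem_iff] at hx
    rw [Submodule.Quotient.mk_eq_zero]
    have hu := isUpperSet_Ioi t₀.last
    obtain ⟨e, c, he⟩ := T.exists_isScaledUnit hu
    change (x : (T.cell r).Cell ν) ∈ T.levelSpan h (Set.Ioi t₀.last) ν
    change _ ∈ T.levelSpan h (Set.Ioi t₀.last) ν at hx
    rw [levelSpan_eq_scaledFixed h hu he] at hx ⊢
    exact mem_scaledFixed_of_smul_mem hb.ne_zero hx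

theorem act_diagonal_twice {s r : ℕ} {t₀ : T.Path s}
    {b : (T.cell s).Cell t₀.last →ₗ[R] T.A s} {q : R} (hb : IsMatrixRow t₀ b q) (h : s ≤ r)
    (ν : (T.cell r).Λ) (x : (T.cell r).Cell ν) :
    ((T.cell r).cellRep ν).act (((T.cell r).cellRep ν).act x
      (T.incl h (b (T.murphy t₀.last t₀)))) (T.incl h (b (T.murphy t₀.last t₀))) =
      q • ((T.cell r).cellRep ν).act x (T.incl h (b (T.murphy t₀.last t₀))) := by
  rw [← RightRep.act_mul, ← map_mul, hb.mul_right, hb.act_self, map_smul, map_smul,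
    RightRep.act_smul]

/-- Over `R` the image is only shown to contain `q` times the range of the diagonal unit; over `F`
this gives the whole range. -/
theorem exists_skewEmbedding_eq {s r : ℕ} {t₀ : T.Path s}
    {b : (T.cell s).Cell t₀.last →ₗ[R] T.A s} {q : R} (hb : IsMatrixRow t₀ b q) (h : s ≤ r)
    (ν : (T.cell r).Λ) (x : (T.cell r).Cell ν) : ∃ y, skewEmbedding hb h ν y =
      q • ((T.cell r).cellRep ν).act x (T.incl h (b (T.murphy t₀.last t₀))) := by
  have hmem : ((T.cell r).cellRep ν).act x (T.incl h (b (T.murphy t₀.last t₀))) ∈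
      T.throughSpan h t₀ ν ⊔ T.aboveSpan h t₀.last ν := by
    rw [hb.through_sup_above_mem_iff]
    refine ⟨hb.act_mem_levelSpan h ν _ x, ?_⟩
    rw [act_diagonal_twice hb, sub_self]
    exact Submodule.zero_mem _
  exact ⟨Submodule.Quotient.mk ⟨_, hmem⟩, act_diagonal_twice hb h ν x⟩

theorem skewEmbedding_act {s r : ℕ} {t₀ : T.Path s}
    {b : (T.cell s).Cell t₀.last →ₗ[R] T.A s} {q : R} (hb : IsMatrixRow t₀ b q) (h : s ≤ r)
    (ν : (T.cell r).Λ)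
    (hU : (T.commutantRep h ν).Stable (T.throughSpan h t₀ ν ⊔ T.aboveSpan h t₀.last ν))
    (hW : (T.commutantRep h ν).Stable (T.aboveSpan h t₀.last ν))
    (y : T.Skew h t₀ ν) (c : T.A (r - s)) :
    skewEmbedding hb h ν ((T.skewRep h t₀ ν hU hW).act y c) =
      ((T.cell r).cellRep ν).act (skewEmbedding hb h ν y) (T.shift h c) := by
  induction y using Submodule.Quotient.induction_on with
  | H x => exact commutantRep_act_comm h ν (T.shift h c) _ x

end DiagramTower

/-! ### The Hom isomorphism over the field of fractions. -/

namespace DiagramTower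

variable {R F : Type*} [CommRing R] [IsDomain R] [Field F] [Algebra R F] [IsFractionRing R F]
  {T : DiagramTower R F}

theorem cellRepF_φ_act_left {s r : ℕ} (h : s ≤ r) (ν : (T.cell r).Λ) (x k : F)
    (v : (T.cell r).Cell ν) (a : T.A s) :
    RightRep.act ((T.cellRepF ν).comp (T.φ h)) (x ⊗ₜ v) ((k ⊗ₜ a) ⊗ₜ 1) =
      (k * x) ⊗ₜ ((T.cell r).cellRep ν).act v (T.incl h a) := by
  change (T.cellRepF ν).act _ (T.φ h _) = _
  rw [φ, Algebra.TensorProduct.lift_tmul, map_one, mul_one, Algebra.TensorProduct.map_tmul]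
  exact RightRep.baseChange_act F _ x k v _

theorem cellRepF_φ_act_right {s r : ℕ} (h : s ≤ r) (ν : (T.cell r).Λ) (x k : F)
    (v : (T.cell r).Cell ν) (c : T.A (r - s)) :
    RightRep.act ((T.cellRepF ν).comp (T.φ h)) (x ⊗ₜ v) (1 ⊗ₜ (k ⊗ₜ c)) =
      (k * x) ⊗ₜ ((T.cell r).cellRep ν).act v (T.shift h c) := by
  change (T.cellRepF ν).act _ (T.φ h _) = _
  rw [φ, Algebra.TensorProduct.lift_tmul, map_one, one_mul, Algebra.TensorProduct.map_tmul]
  exact RightRep.baseChange_act F _ x k v _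

theorem nonempty_hom_equiv_hom_skew {s r : ℕ} (h : s ≤ r) (t₀ : T.Path s) (ν : (T.cell r).Λ)
    (hU : (T.commutantRep h ν).Stable (T.throughSpan h t₀ ν ⊔ T.aboveSpan h t₀.last ν))
    (hW : (T.commutantRep h ν).Stable (T.aboveSpan h t₀.last ν))
    {M : Type*} [AddCommGroup M] [Module F M] (μ : RightRep F (T.AF (r - s)) M) :
    Nonempty (↥(RightRep.hom (RightRep.outer (T.cellRepF t₀.last) μ)
        ((T.cellRepF ν).comp (T.φ h))) ≃ₗ[F]
      ↥(RightRep.hom μ (RightRep.baseChange F (T.skewRep h t₀ ν hU hW)))) := by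
  obtain ⟨b, q, hb⟩ := exists_isMatrixRow t₀
  have hq : algebraMap R F q ≠ 0 := by simpa using hb.ne_zero
  let k : F := (algebraMap R F q)⁻¹
  have hkq : ∀ (x : F) {V : Type _} [AddCommGroup V] [Module R V] (v : V),
      (k * x) ⊗ₜ[R] (q • v) = x ⊗ₜ[R] v := by
    intro x V _ _ v
    rw [TensorProduct.tmul_smul, TensorProduct.smul_tmul', Algebra.smul_def, ← mul_assoc,
      mul_inv_cancel₀ hq, one_mul]
  -- Dividing by `q` turns the scaled row into genuine matrix units, so that `ℓ · bF x = x` below.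
  let bF : F ⊗[R] (T.cell s).Cell t₀.last →ₗ[F] T.AF s := k • b.baseChange F
  have hbF : ∀ x v, bF (x ⊗ₜ v) = (k * x) ⊗ₜ b v := by
    intro x v
    change k • (x ⊗ₜ[R] b v) = _
    rw [TensorProduct.smul_tmul', smul_eq_mul]
  let g := skewEmbedding hb h ν
  have hgF : ∀ x y, g.baseChange F (x ⊗ₜ y) = x ⊗ₜ g y := fun x y => rfl
  have hginj : Function.Injective (g.baseChange F) := by
    have : Module.Flat R F := IsLocalization.flat F (nonZeroDivisors R)
    exact Module.Flat.lTensor_preserves_injective_linearMap g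
      (skewEmbedding_injective hb h ν)
  let ℓ : F ⊗[R] (T.cell s).Cell t₀.last := 1 ⊗ₜ T.murphy t₀.last t₀
  refine RightRep.nonempty_hom_outer_equiv _ _ _ _ bF ℓ (g.baseChange F) ?_ ?_ hginj ?_ ?_ ?_
  · intro z
    induction z using TensorProduct.induction_on with
    | zero => rw [map_zero, RightRep.act_zero]
    | add z z' hz hz' => rw [map_add, RightRep.act_add, hz, hz']
    | tmul x v =>
      rw [hbF]
      refine (RightRep.baseChange_act F _ _ _ _ _).trans ?_
      rw [hb.act_self, mul_one, hkq]
  · intro w z a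
    induction w using TensorProduct.induction_on with
    | zero => simp only [RightRep.zero_act]
    | add w w' hw hw' => simp only [RightRep.add_act, hw, hw']
    | tmul y w =>
      induction a using TensorProduct.induction_on with
      | zero => simp only [TensorProduct.zero_tmul, RightRep.act_zero, map_zero]
      | add a a' ha ha' =>
        simp only [TensorProduct.add_tmul, RightRep.act_add, map_add] at ha ha' ⊢
        rw [ha, ha']
      | tmul c a =>
        induction z using TensorProduct.induction_on with
        | zero => simp only [map_zero, TensorProduct.zero_tmul, RightRep.act_zero,
            RightRep.zero_act]
        | add z z' hz hz' =>
          simp only [map_add, TensorProduct.add_tmul, RightRep.act_add, RightRep.add_act]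
            at hz hz' ⊢
          rw [hz, hz']
        | tmul x v =>
          have h1 : (T.cellRepF t₀.last).act (x ⊗ₜ[R] v) (c ⊗ₜ[R] a) =
              (c * x) ⊗ₜ ((T.cell s).cellRep t₀.last).act v a :=
            RightRep.baseChange_act F _ _ _ _ _
          rw [h1, hbF, hbF, cellRepF_φ_act_left, cellRepF_φ_act_left, cellRepF_φ_act_left,
            ← hb.mul_right, map_mul, RightRep.act_mul]
          congr 1
          ring
  · intro z
    induction z using TensorProduct.induction_on with
    | zero => rw [map_zero, RightRep.zero_act]
    | add z z' hz hz' => rw [map_add, RightRep.add_act, hz, hz']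
    | tmul x y =>
      rw [hgF, hbF, cellRepF_φ_act_left, mul_one]
      induction y using Submodule.Quotient.induction_on with
      | H y =>
        rw [show g (Submodule.Quotient.mk y) = _ from skewEmbedding_mk hb h ν y,
          act_diagonal_twice hb, hkq]
  · intro w
    induction w using TensorProduct.induction_on with
    | zero => rw [RightRep.zero_act]; exact Submodule.zero_mem _
    | add w w' hw hw' => rw [RightRep.add_act]; exact Submodule.add_mem _ hw hw'
    | tmul x v =>
      rw [hbF, cellRepF_φ_act_left, mul_one]
      obtain ⟨y, hy⟩ := exists_skewEmbedding_eq hb h ν v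
      -- One factor `k` comes from `bF`; the other cancels the `q` of `exists_skewEmbedding_eq`.
      refine ⟨(k * (k * x)) ⊗ₜ y, ?_⟩
      rw [hgF, show g y = _ from hy, hkq]
  · intro z c
    induction z using TensorProduct.induction_on with
    | zero => rw [RightRep.zero_act, map_zero, RightRep.zero_act]
    | add z z' hz hz' => rw [RightRep.add_act, map_add, map_add, RightRep.add_act, hz, hz']
    | tmul x y =>
      induction c using TensorProduct.induction_on with
      | zero => rw [RightRep.act_zero, map_zero, TensorProduct.tmul_zero, RightRep.act_zero]
      | add c c' hc hc' =>
        rw [RightRep.act_add, map_add, TensorProduct.tmul_add, RightRep.act_add, hc, hc']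
      | tmul p c =>
        rw [RightRep.baseChange_act, hgF, hgF, cellRepF_φ_act_right]
        exact congrArg _ (skewEmbedding_act hb h ν hU hW y c)

end DiagramTower

theorem mainTheorem5 {R : Type*} {F : Type*} [CommRing R] [IsDomain R] [Field F] [Algebra R F]
    [IsFractionRing R F] (T : DiagramTower R F) {s r : ℕ} (h : s ≤ r)
    (l : (T.cell s).Λ) (ν : (T.cell r).Λ) :
    (∃ t₀ : T.Path s, t₀.last = l ∧ t₀.IsMaximal) ∧
    ∀ t₀ : T.Path s, t₀.last = l → t₀.IsMaximal →
      ∃ (hU : (T.commutantRep h ν).Stable (T.throughSpan h t₀ ν ⊔ T.aboveSpan h t₀.last ν))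
        (hW : (T.commutantRep h ν).Stable (T.aboveSpan h t₀.last ν)),
        ∀ (M : Type*) [AddCommGroup M] [Module F M] [Module (T.AF (r - s))ᵐᵒᵖ M]
          [IsScalarTower F (T.AF (r - s))ᵐᵒᵖ M],
          Nonempty
            (↥(RightRep.hom
                (RightRep.outer (T.cellRepF l) (RightRep.ofModule F (T.AF (r - s)) M))
                ((T.cellRepF ν).comp (T.φ h))) ≃ₗ[F]
              ↥(RightRep.hom
                (RightRep.ofModule F (T.AF (r - s)) M)
                (RightRep.baseChange F (T.skewRep h t₀ ν hU hW)))) := by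
  refine ⟨T.exists_maximal_path s l, ?_⟩
  rintro t₀ rfl -
  exact ⟨DiagramTower.through_sup_above_stable h t₀ ν, DiagramTower.aboveSpan_stable h t₀.last ν,
    fun M _ _ _ _ => DiagramTower.nonempty_hom_equiv_hom_skew h t₀ ν _ _ _⟩
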